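/- Let $K\subset S^3$ be a (tame) knot. Let $M_K$ be the complement of the interior of a regular neighbourhood of $K$, and let $\Sigma_K=\partial M_K$ be its boundary torus. For a representation $\rho\colon\pi_1(M_K)\to SL(2,\mathbb{C})$, let $H^i(M_K;\rho)$ be the cohomology of $M_K$ with coefficients in $sl_2(\mathbb{C})$ twisted by the adjoint action of $\rho$, let $\rho'$ be the restriction of $\rho$ to $\pi_1(\Sigma_K)$, and put \[ \delta^{\mathrm{rep}}_K(\rho)=3+h^1(M_K;\rho)-h^0(M_K;\rho), \] where \[ h^0(M_K;\rho)=\dim_{\mathbb{C}} H^0(M_K;\rho),\qquad h^1(M_K;\rho)=\dim_{\mathbb{C}}\operatorname{Ker}\bigl[H^1(M_K;\rho)\to H^1(\Sigma_K;\rho')\bigr]. \] Then there exist open sets $U_1\ni I$ and $U_2\ni -I$ of $SL(2,\mathbb{C})$, depending only on $K$, with the following property. If $\rho$ is a representation of $\pi_1(M_K)$ in $SL(2,\mathbb{C})$ with commutative image which sends the meridian $\mu$ into $U_1\cup U_2$, and $\rho(\mu)\neq\pm I$, then both of these dimensions are finite and $\delta^{\mathrm{rep}}_K(\rho)=2$.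 -/

import Mathlib

set_option maxSynthPendingDepth 3

open scoped MatrixGroups Topology

noncomputable section

/-! ### Singular cohomology with coefficients twisted by a representation

`X` is a space with basepoint `x₀` and `ρ` a representation of `π₁(X, x₀)` on `V`.  A lift of a
singular simplex `σ` of `X` to the universal cover is the same thing as a homotopy class of paths
from `x₀` to the vertex `0` of `σ`.  Hence an element of `Hom_{ℤ[π₁]}(C_n(universal cover), V)` is a
function of pairs `(σ, p)`, where `p` is such a class, which is equivariant under `π₁(X, x₀)`. -/

namespace TwistedCohomology

variable {X Y : Type*} [TopologicalSpace X] [TopologicalSpace Y]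
variable {V : Type*} [AddCommGroup V] [Module ℂ V]

/-- The standard `n`-simplex, with vertices `0, …, n`. -/
abbrev Simplex (n : ℕ) : Type := stdSimplex ℝ (Fin (n + 1))

/-- The `i`-th face of a singular simplex. -/
def face {n : ℕ} (i : Fin (n + 2)) (σ : C(Simplex (n + 1), X)) : C(Simplex n, X) :=
  σ.comp ⟨stdSimplex.map i.succAbove, stdSimplex.continuous_map _⟩

/-- The straight path in the standard simplex from the vertex `i` to the vertex `j`. -/
def simplexEdge {n : ℕ} (i j : Fin (n + 1)) :
    Path (stdSimplex.vertex i : Simplex n) (stdSimplex.vertex j) where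
  toFun t := ⟨AffineMap.lineMap (Pi.single i 1 : Fin (n + 1) → ℝ) (Pi.single j 1) (t : ℝ),
    (convex_stdSimplex ℝ _).lineMap_mem (single_mem_stdSimplex ℝ i) (single_mem_stdSimplex ℝ j)
      t.2⟩
  continuous_toFun := Continuous.subtype_mk
    (AffineMap.lineMap_continuous.comp continuous_subtype_val) _
  source' := by ext; simp
  target' := by ext; simp

/-- The path from the vertex `0` of `σ` to the vertex `0` of the `i`-th face of `σ` (which is the
vertex `1` of `σ` if `i = 0`, and the vertex `0` of `σ` otherwise), along a straight line. -/
def edge {n : ℕ} (i : Fin (n + 2)) (σ : C(Simplex (n + 1), X)) :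
    Path (σ (stdSimplex.vertex 0)) (face i σ (stdSimplex.vertex 0)) :=
  ((simplexEdge 0 (i.succAbove 0)).map σ.continuous).cast rfl (by simp [face])

/-- The singular `n`-simplices of the universal cover of `X`: pairs of a singular simplex `σ` of `X`
and a homotopy class of paths from `x₀` to the vertex `0` of `σ`. -/
abbrev LiftedSimplex (x₀ : X) (n : ℕ) : Type _ :=
  Σ σ : C(Simplex n, X), Path.Homotopic.Quotient x₀ (σ (stdSimplex.vertex 0))

/-- The `i`-th face of a singular simplex of the universal cover. -/
def liftedFace {x₀ : X} {n : ℕ} (i : Fin (n + 2)) (s : LiftedSimplex x₀ (n + 1)) :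
    LiftedSimplex x₀ n :=
  ⟨face i s.1, s.2.trans (.mk (edge i s.1))⟩

/-- The action of the fundamental group on the simplices of the universal cover.  In Mathlib the
product `γ * γ'` in the fundamental group is the path that first runs through `γ'`, so this is a
right action. -/
def act {x₀ : X} {n : ℕ} (s : LiftedSimplex x₀ n) (γ : FundamentalGroup X x₀) :
    LiftedSimplex x₀ n :=
  ⟨s.1, γ.toPath.trans s.2⟩

theorem liftedFace_act {x₀ : X} {n : ℕ} (i : Fin (n + 2)) (s : LiftedSimplex x₀ (n + 1))
    (γ : FundamentalGroup X x₀) : liftedFace i (act s γ) = act (liftedFace i s) γ := by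
  simp [liftedFace, act, Path.Homotopic.Quotient.trans_assoc]

/-- Singular `n`-cochains of `X` with coefficients in `V` twisted by `ρ`. -/
def cochains {x₀ : X} (ρ : Representation ℂ (FundamentalGroup X x₀) V) (n : ℕ) :
    Submodule ℂ (LiftedSimplex x₀ n → V) where
  carrier := {c | ∀ s γ, c (act s γ) = ρ γ⁻¹ (c s)}
  zero_mem' s γ := by simp
  add_mem' ha hb s γ := by simp [ha s γ, hb s γ]
  smul_mem' r c hc s γ := by simp [hc s γ]

/-- The coboundary `(d c)(s) = ∑ i, (-1) ^ i • c (i-th face of s)`. -/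
def coboundary {x₀ : X} (ρ : Representation ℂ (FundamentalGroup X x₀) V) (n : ℕ) :
    cochains ρ n →ₗ[ℂ] cochains ρ (n + 1) where
  toFun c := ⟨fun s => ∑ i : Fin (n + 2), (-1 : ℂ) ^ (i : ℕ) • c.1 (liftedFace i s), by
    intro s γ
    simp only [map_sum, map_smul, liftedFace_act]
    exact Finset.sum_congr rfl fun i _ => by rw [← c.2]⟩
  map_add' a b := by
    ext s
    simp [Finset.sum_add_distrib]
  map_smul' r a := by
    ext s
    simp [Finset.smul_sum, smul_comm r]

/-- The `n`-cocycles. -/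
def cocycles {x₀ : X} (ρ : Representation ℂ (FundamentalGroup X x₀) V) (n : ℕ) :
    Submodule ℂ (cochains ρ n) :=
  LinearMap.ker (coboundary ρ n)

/-- The `n`-coboundaries. -/
def coboundaries {x₀ : X} (ρ : Representation ℂ (FundamentalGroup X x₀) V) :
    (n : ℕ) → Submodule ℂ (cochains ρ n)
  | 0 => ⊥
  | n + 1 => LinearMap.range (coboundary ρ n)

/-- The twisted cohomology `Hⁿ(X; ρ)`. -/
abbrev H {x₀ : X} (ρ : Representation ℂ (FundamentalGroup X x₀) V) (n : ℕ) : Type _ :=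
  cocycles ρ n ⧸ (coboundaries ρ n).submoduleOf (cocycles ρ n)

/-- The representation of `π₁(X, x₀)` obtained from `ρ` by means of a continuous map `f : X → Y`. -/
abbrev pullbackRep (f : C(X, Y)) (x₀ : X)
    (ρ : Representation ℂ (FundamentalGroup Y (f x₀)) V) :
    Representation ℂ (FundamentalGroup X x₀) V :=
  ρ.comp (FundamentalGroup.map f x₀)

/-- The map of singular simplices of the universal covers induced by a continuous map. -/
def liftedMap (f : C(X, Y)) (x₀ : X) {n : ℕ} (s : LiftedSimplex x₀ n) :
    LiftedSimplex (f x₀) n :=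
  ⟨f.comp s.1, s.2.map f⟩

theorem liftedMap_act (f : C(X, Y)) (x₀ : X) {n : ℕ} (s : LiftedSimplex x₀ n)
    (γ : FundamentalGroup X x₀) :
    liftedMap f x₀ (act s γ) = act (liftedMap f x₀ s) (FundamentalGroup.map f x₀ γ) :=
  congrArg (Sigma.mk (f.comp s.1)) ((FundamentalGroupoid.map f).map_comp (X := ⟨x₀⟩) (Y := ⟨x₀⟩)
    (Z := ⟨s.1 (stdSimplex.vertex 0)⟩) γ s.2)

theorem liftedMap_liftedFace (f : C(X, Y)) (x₀ : X) {n : ℕ} (i : Fin (n + 2))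
    (s : LiftedSimplex x₀ (n + 1)) :
    liftedMap f x₀ (liftedFace i s) = liftedFace i (liftedMap f x₀ s) :=
  congrArg (Sigma.mk (f.comp (face i s.1))) ((FundamentalGroupoid.map f).map_comp (X := ⟨x₀⟩)
    (Y := ⟨s.1 (stdSimplex.vertex 0)⟩) (Z := ⟨face i s.1 (stdSimplex.vertex 0)⟩) s.2
    (.mk (edge i s.1)))

/-- The cochain map induced by a continuous map. -/
def cochainMap (f : C(X, Y)) (x₀ : X) (ρ : Representation ℂ (FundamentalGroup Y (f x₀)) V)
    (n : ℕ) : cochains ρ n →ₗ[ℂ] cochains (pullbackRep f x₀ ρ) n where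
  toFun c := ⟨fun s => c.1 (liftedMap f x₀ s), by
    intro s γ
    beta_reduce
    rw [liftedMap_act, c.2, ← map_inv]
    rfl⟩
  map_add' _ _ := rfl
  map_smul' _ _ := rfl

theorem cochainMap_coboundary (f : C(X, Y)) (x₀ : X)
    (ρ : Representation ℂ (FundamentalGroup Y (f x₀)) V) (n : ℕ) (c : cochains ρ n) :
    cochainMap f x₀ ρ (n + 1) (coboundary ρ n c) =
      coboundary (pullbackRep f x₀ ρ) n (cochainMap f x₀ ρ n c) := by
  refine Subtype.ext (funext fun s => ?_)
  change ∑ i : Fin (n + 2), (-1 : ℂ) ^ (i : ℕ) • c.1 (liftedFace i (liftedMap f x₀ s)) =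
    ∑ i : Fin (n + 2), (-1 : ℂ) ^ (i : ℕ) • c.1 (liftedMap f x₀ (liftedFace i s))
  refine Finset.sum_congr rfl fun i _ => ?_
  exact congrArg (fun s => (-1 : ℂ) ^ (i : ℕ) • c.1 s) (liftedMap_liftedFace f x₀ i s).symm

/-- The linear map `Hⁿ(Y; ρ) → Hⁿ(X; ρ ∘ f_*)` induced by a continuous map `f : X → Y`. -/
def cohomologyMap (f : C(X, Y)) (x₀ : X) (ρ : Representation ℂ (FundamentalGroup Y (f x₀)) V)
    (n : ℕ) : H ρ n →ₗ[ℂ] H (pullbackRep f x₀ ρ) n :=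
  Submodule.mapQ ((coboundaries ρ n).submoduleOf (cocycles ρ n))
    ((coboundaries (pullbackRep f x₀ ρ) n).submoduleOf (cocycles (pullbackRep f x₀ ρ) n))
    ((cochainMap f x₀ ρ n).restrict (p := cocycles ρ n) (q := cocycles (pullbackRep f x₀ ρ) n) (by
      intro c hc
      have hc : coboundary ρ n c = 0 := hc
      change coboundary (pullbackRep f x₀ ρ) n (cochainMap f x₀ ρ n c) = 0
      rw [← cochainMap_coboundary, hc, map_zero]))
    (by
      rintro ⟨c, hc⟩ hb
      have hb : c ∈ coboundaries ρ n := hb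
      change cochainMap f x₀ ρ n c ∈ coboundaries (pullbackRep f x₀ ρ) n
      cases n with
      | zero =>
        have hb : c = 0 := hb
        rw [hb, map_zero]
        exact Submodule.zero_mem _
      | succ n =>
        obtain ⟨b, rfl⟩ := hb
        exact ⟨cochainMap f x₀ ρ n b, (cochainMap_coboundary f x₀ ρ n b).symm⟩)

end TwistedCohomology

/-! ### The adjoint representation -/

/-- The Lie algebra `sl₂(ℂ)` of traceless matrices. -/
abbrev SL2LieAlgebra : Type := LieAlgebra.SpecialLinear.sl (Fin 2) ℂ

/-- The adjoint representation `A ↦ (X ↦ A X A⁻¹)` of `SL(2, ℂ)` on `sl₂(ℂ)`. -/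
def adjointRep : Representation ℂ SL(2, ℂ) SL2LieAlgebra where
  toFun A :=
    { toFun := fun X => ⟨(A : Matrix (Fin 2) (Fin 2) ℂ) * X.1 * (A⁻¹ : SL(2, ℂ)), by
        have hX : Matrix.trace X.1 = 0 := X.2
        change Matrix.trace ((A : Matrix (Fin 2) (Fin 2) ℂ) * X.1 *
          ((A⁻¹ : SL(2, ℂ)) : Matrix (Fin 2) (Fin 2) ℂ)) = 0
        rw [Matrix.trace_mul_cycle, ← Matrix.SpecialLinearGroup.coe_mul]
        simpa only [inv_mul_cancel, Matrix.SpecialLinearGroup.coe_one, one_mul] using hX⟩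
      map_add' := fun X Y => by
        apply Subtype.ext
        simp [mul_add, add_mul]
      map_smul' := fun r X => by
        apply Subtype.ext
        simp }
  map_one' := by
    ext X : 1
    apply Subtype.ext
    simp
  map_mul' A B := by
    ext X : 1
    apply Subtype.ext
    simp only [mul_inv_rev, Matrix.SpecialLinearGroup.coe_mul, LinearMap.coe_mk, AddHom.coe_mk,
      Module.End.mul_apply, Matrix.mul_assoc]

/-! ### Knots in the 3-sphere -/

/-- The three-sphere. -/
abbrev S3 : Type := Metric.sphere (0 : EuclideanSpace ℝ (Fin 4)) 1

/-- A tubular neighbourhood of `K ⊆ S³`: an open embedding of `S¹ × ℝ²` in `S³` that maps the zero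
section `S¹ × {0}` onto `K`.  The regular neighbourhood `N(K)` that it determines is the image of
`S¹ × D²`, where `D²` is the closed unit disk; it is a solid torus with a bicollared boundary. -/
structure TubularNeighbourhood (K : Set S3) where
  /-- The open embedding. -/
  toFun : Circle × ℂ → S3
  isOpenEmbedding : Topology.IsOpenEmbedding toFun
  range_core : Set.range (fun z : Circle => toFun (z, 0)) = K

/-- (Tame) knots in `S³`, as point sets: the embedded circles that have a tubular neighbourhood.
All smooth and all polygonal knots are such. -/
def IsKnot (K : Set S3) : Prop := Nonempty (TubularNeighbourhood K)

namespace TubularNeighbourhood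

variable {K : Set S3} (N : TubularNeighbourhood K)

/-- The knot exterior `M_K`: the complement of the interior of `N(K)`. -/
def exterior : Set S3 := (N.toFun '' {x | ‖x.2‖ < 1})ᶜ

/-- The boundary torus `Σ_K` of the knot exterior. -/
def boundary : Set S3 := N.toFun '' {x | ‖x.2‖ = 1}

theorem boundary_subset_exterior : N.boundary ⊆ N.exterior := by
  rintro _ ⟨x, hx, rfl⟩ ⟨y, hy, hxy⟩
  have hx : ‖x.2‖ = 1 := hx
  have hy : ‖y.2‖ < 1 := hy
  rw [N.isOpenEmbedding.injective hxy] at hy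
  exact hy.ne hx

/-- The inclusion of `Σ_K` in `M_K`. -/
def inclusion : C(N.boundary, N.exterior) :=
  ⟨Set.inclusion N.boundary_subset_exterior, continuous_inclusion _⟩

/-- The point of `Σ_K` with the coordinates `(z, w)`. -/
def boundaryPoint (z w : Circle) : N.boundary := ⟨N.toFun (z, w), (z, w), Circle.norm_coe w, rfl⟩

theorem continuous_boundaryPoint (z : Circle) : Continuous (N.boundaryPoint z) :=
  Continuous.subtype_mk (N.isOpenEmbedding.continuous.comp (by fun_prop)) _

/-- The basepoint, which lies on `Σ_K`. -/
def basepoint : N.boundary := N.boundaryPoint 1 1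

/-- The knot group `π₁(M_K)`. -/
abbrev knotGroup : Type := FundamentalGroup N.exterior (N.inclusion N.basepoint)

/-- The meridian `t ↦ (1, exp (2πit))` as a loop on `Σ_K`. -/
def meridianLoop : Path N.basepoint N.basepoint where
  toFun t := N.boundaryPoint 1 (Circle.exp (2 * Real.pi * (t : ℝ)))
  continuous_toFun := (N.continuous_boundaryPoint 1).comp (by fun_prop)
  source' := by simp [basepoint]
  target' := by simp [basepoint]

/-- The meridian as an element of the knot group. -/
def meridian : N.knotGroup :=
  FundamentalGroup.map N.inclusion N.basepoint (FundamentalGroup.fromPath (.mk N.meridianLoop))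

/-- The representation of the knot group on `sl₂(ℂ)` given by `ρ` and the adjoint action. -/
def adRep (ρ : N.knotGroup →* SL(2, ℂ)) : Representation ℂ N.knotGroup SL2LieAlgebra :=
  adjointRep.comp ρ

/-- The kernel of the restriction `H¹(M_K; ρ) → H¹(Σ_K; ρ')`, where `ρ'` is the restriction of `ρ`
to the fundamental group of `Σ_K`. -/
def restrictionKernel (ρ : N.knotGroup →* SL(2, ℂ)) :
    Submodule ℂ (TwistedCohomology.H (N.adRep ρ) 1) :=
  LinearMap.ker (TwistedCohomology.cohomologyMap N.inclusion N.basepoint (N.adRep ρ) 1)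

/-- `h⁰(M_K; ρ) = dim H⁰(M_K; ρ)`. -/
def h0 (ρ : N.knotGroup →* SL(2, ℂ)) : ℕ :=
  Module.finrank ℂ (TwistedCohomology.H (N.adRep ρ) 0)

/-- `h¹(M_K; ρ) = dim Ker [H¹(M_K; ρ) → H¹(Σ_K; ρ')]`. -/
def h1 (ρ : N.knotGroup →* SL(2, ℂ)) : ℕ := Module.finrank ℂ (N.restrictionKernel ρ)

/-- `δ^rep_K(ρ) = 3 + h¹(M_K; ρ) - h⁰(M_K; ρ)`. -/
def deltaRep (ρ : N.knotGroup →* SL(2, ℂ)) : ℤ := 3 + (N.h1 ρ : ℤ) - (N.h0 ρ : ℤ)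

end TubularNeighbourhood

end

/-!
Write `W = S³ \ K`, and let `μ` be the meridian of the knot exterior `M`.

*The number `h⁰`.*  The group `π₁(M)` is normally generated by `μ`.  Since `ρ` has commutative
image, its image is therefore the cyclic group generated by `ρ(μ)`, and `H⁰(M; ρ)`, the space of
invariants of the adjoint action, is the centralizer of `ρ(μ)` in `sl₂(ℂ)`.  As `ρ(μ) ≠ ±1`, it
has dimension one (`finrank_invariants_eq_one`).

*The number `h¹`.*  A class in the kernel of the restriction to the boundary torus is given by a
crossed homomorphism `y : π₁(M) → sl₂(ℂ)` with `y(μ) = Ad ρ(μ) v - v` for some `v`.  After a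
principal crossed homomorphism has been subtracted, `y(μ) = 0`.  Choose a finite set of generators
`x = w μ w⁻¹` of the group.  The image of `ρ` is commutative, so that `y(x) = y(w) - Ad ρ(x) y(w)
= y(w) - Ad ρ(μ) y(w)`, and if `ρ(μ)` is close to `±1`, then this is small compared with `y(w)`,
hence compared with the largest value of `y` on the generators.  Applied to all of the generators,
this gives `y = 0`.  The bound depends only on the words `w` in the generators
(`exists_pos_forall_crossedHom_principal`).  Hence the kernel vanishes, and `δ = 3 + 0 - 1 = 2`.

The topological input consists of four facts about `W`.

* `π₁(W)` is finitely generated (`TubularNeighbourhood.fg_fundamentalGroup_compl`): its loops can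
  be deformed into the compact exterior, and loops in a compact subset of a locally contractible
  space generate a finitely generated subgroup (`exists_fg_forall_transport_mem`).
* `π₁(W)` is normally generated by the meridian
  (`TubularNeighbourhood.normalClosure_complMeridian`). Instead of van Kampen's theorem this uses
  local systems: a homomorphism from `π₁(W)` that kills the meridian gives a local system on `W`
  that extends over the knot.  On the sphere every local system has a global flat section
  (`FlatAtlas.exists_isFlatOn_univ`), so the homomorphism is trivial.
* Up to conjugation and inversion, the meridian does not depend on the tubular neighbourhood
  (`TubularNeighbourhood.isConj_complMeridian`).  This makes the open sets depend on `K` only.  In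
  logarithmic polar coordinates, the inclusion of a thin neighbourhood in another one has a
  winding number around the knot, which is invertible because winding numbers are multiplicative.
* The exterior is a deformation retract of `W`, so that `π₁(W)` maps onto the knot group, meridian
  to meridian (`TubularNeighbourhood.exists_surjective_map_complMeridian`).
-/

/-! ### Crossed homomorphisms of groups that are normally generated by one element -/

section CrossedHom

variable {Γ : Type*} [Group Γ]

/-- Crossed homomorphisms (`1`-cocycles) of a group with values in a representation. -/
def IsCrossedHom {V : Type*} [AddCommGroup V] [Module ℂ V] (ρ : Representation ℂ Γ V)
    (z : Γ → V) : Prop :=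
  ∀ g h, z (g * h) = z g + ρ g (z h)

namespace IsCrossedHom

variable {V : Type*} [AddCommGroup V] [Module ℂ V] {ρ : Representation ℂ Γ V} {z : Γ → V}

theorem map_one (hz : IsCrossedHom ρ z) : z 1 = 0 := by
  have h := hz 1 1
  simpa using h

theorem map_inv (hz : IsCrossedHom ρ z) (g : Γ) : z g⁻¹ = -ρ g⁻¹ (z g) := by
  have h := hz g⁻¹ g
  rw [inv_mul_cancel, hz.map_one] at h
  exact eq_neg_of_add_eq_zero_left h.symm

theorem map_conj (hz : IsCrossedHom ρ z) (w g : Γ) :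
    z (w * g * w⁻¹) = z w + ρ w (z g) - ρ (w * g * w⁻¹) (z w) := by
  rw [hz, hz, hz.map_inv, _root_.map_neg, ← Module.End.mul_apply (ρ (w * g)), ← _root_.map_mul,
    sub_eq_add_neg]

theorem sub_principal (hz : IsCrossedHom ρ z) (v : V) :
    IsCrossedHom ρ (fun g => z g - (ρ g v - v)) := by
  intro g h
  simp only [hz g h, map_sub, _root_.map_mul, Module.End.mul_apply]
  abel

theorem comp (hz : IsCrossedHom ρ z) {Γ' : Type*} [Group Γ'] (f : Γ' →* Γ) :
    IsCrossedHom (ρ.comp f) (fun g => z (f g)) := by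
  intro g h
  simp [hz (f g) (f h)]

theorem principal_conj (hz : IsCrossedHom ρ z) {g : Γ} (hg : ∃ v, z g = ρ g v - v) (w : Γ) :
    ∃ v, z (w * g * w⁻¹) = ρ (w * g * w⁻¹) v - v := by
  obtain ⟨v, hv⟩ := hg
  refine ⟨ρ w v - z w, ?_⟩
  rw [hz.map_conj, hv]
  simp only [map_sub, _root_.map_mul, Module.End.mul_apply, Representation.inv_self_apply]
  abel

theorem principal_inv (hz : IsCrossedHom ρ z) {g : Γ} (hg : ∃ v, z g = ρ g v - v) :
    ∃ v, z g⁻¹ = ρ g⁻¹ v - v := by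
  obtain ⟨v, hv⟩ := hg
  refine ⟨v, ?_⟩
  rw [hz.map_inv, hv]
  simp

end IsCrossedHom

/-- The size of a crossed homomorphism at `g` is controlled by its size on a generating set, with a
constant that does not depend on the representation as long as the generators and their inverses
at most double the seminorm. -/
theorem exists_crossedHom_bound {X : Set Γ} (hX : Subgroup.closure X = ⊤) (g : Γ) :
    ∃ C D : ℝ, 0 ≤ C ∧ 0 ≤ D ∧ ∀ (V : Type) [AddCommGroup V] [Module ℂ V]
      (ρ : Representation ℂ Γ V) (p : Seminorm ℂ V) (z : Γ → V) (m : ℝ), IsCrossedHom ρ z →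
      (∀ x ∈ X, ∀ v, p (ρ x v) ≤ 2 * p v ∧ p (ρ x⁻¹ v) ≤ 2 * p v) → (∀ x ∈ X, p (z x) ≤ m) →
      (∀ v, p (ρ g v) ≤ D * p v) ∧ (∀ v, p (ρ g⁻¹ v) ≤ D * p v) ∧ p (z g) ≤ C * m := by
  have hg : g ∈ Subgroup.closure X := hX ▸ Subgroup.mem_top g
  induction hg using Subgroup.closure_induction with
  | mem x hx =>
    exact ⟨1, 2, by norm_num, by norm_num, fun V _ _ ρ p z m hz h₁ h₂ =>
      ⟨fun v => (h₁ x hx v).1, fun v => (h₁ x hx v).2, by simpa using h₂ x hx⟩⟩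
  | one =>
    exact ⟨0, 1, le_rfl, zero_le_one, fun V _ _ ρ p z m hz h₁ h₂ =>
      ⟨by simp, by simp, by simp [hz.map_one]⟩⟩
  | mul x y _ _ hx hy =>
    obtain ⟨C₁, D₁, hC₁, hD₁, H₁⟩ := hx
    obtain ⟨C₂, D₂, hC₂, hD₂, H₂⟩ := hy
    refine ⟨C₁ + D₁ * C₂, D₁ * D₂, by positivity, by positivity, ?_⟩
    intro V _ _ ρ p z m hz h₁ h₂
    obtain ⟨a₁, b₁, c₁⟩ := H₁ V ρ p z m hz h₁ h₂
    obtain ⟨a₂, b₂, c₂⟩ := H₂ V ρ p z m hz h₁ h₂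
    refine ⟨fun v => ?_, fun v => ?_, ?_⟩
    · rw [map_mul, Module.End.mul_apply, mul_assoc]
      exact (a₁ _).trans (mul_le_mul_of_nonneg_left (a₂ v) hD₁)
    · rw [mul_inv_rev, map_mul, Module.End.mul_apply, mul_comm D₁, mul_assoc]
      exact (b₂ _).trans (mul_le_mul_of_nonneg_left (b₁ v) hD₂)
    · rw [hz]
      calc p (z x + ρ x (z y)) ≤ p (z x) + p (ρ x (z y)) := map_add_le_add p _ _
        _ ≤ C₁ * m + D₁ * (C₂ * m) :=
          add_le_add c₁ ((a₁ _).trans (mul_le_mul_of_nonneg_left c₂ hD₁))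
        _ = (C₁ + D₁ * C₂) * m := by ring
  | inv x _ hx =>
    obtain ⟨C, D, hC, hD, H⟩ := hx
    refine ⟨D * C, D, by positivity, hD, ?_⟩
    intro V _ _ ρ p z m hz h₁ h₂
    obtain ⟨a, b, c⟩ := H V ρ p z m hz h₁ h₂
    refine ⟨b, by simpa using a, ?_⟩
    rw [hz.map_inv, map_neg_eq_map, mul_assoc]
    exact (b _).trans (mul_le_mul_of_nonneg_left c hD)

theorem exists_finset_subset_closure_eq_top [Group.FG Γ] {Y : Set Γ}
    (hY : Subgroup.closure Y = ⊤) :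
    ∃ T : Finset Γ, (T : Set Γ) ⊆ Y ∧ Subgroup.closure (T : Set Γ) = ⊤ := by
  classical
  have key : ∀ g : Γ, ∃ T : Finset Γ, (T : Set Γ) ⊆ Y ∧ g ∈ Subgroup.closure (T : Set Γ) := by
    intro g
    have hg : g ∈ Subgroup.closure Y := hY ▸ Subgroup.mem_top g
    induction hg using Subgroup.closure_induction with
    | mem x hx => exact ⟨{x}, by simpa using hx, Subgroup.subset_closure (by simp)⟩
    | one => exact ⟨∅, by simp, Subgroup.one_mem _⟩
    | mul x y _ _ hx hy =>
      obtain ⟨T₁, h₁, m₁⟩ := hx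
      obtain ⟨T₂, h₂, m₂⟩ := hy
      refine ⟨T₁ ∪ T₂, by simp [h₁, h₂], Subgroup.mul_mem _ ?_ ?_⟩
      · exact Subgroup.closure_mono (by simp) m₁
      · exact Subgroup.closure_mono (by simp) m₂
    | inv x _ hx =>
      obtain ⟨T, h, m⟩ := hx
      exact ⟨T, h, Subgroup.inv_mem _ m⟩
  choose T hT hmem using key
  obtain ⟨S, hS⟩ := Group.fg_def.1 (inferInstance : Group.FG Γ)
  refine ⟨S.biUnion T, by simpa using fun g _ => hT g, ?_⟩
  rw [eq_top_iff, ← hS, Subgroup.closure_le]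
  intro g hg
  refine Subgroup.closure_mono ?_ (hmem g)
  exact_mod_cast Finset.subset_biUnion_of_mem T hg

/-- Let `Γ` be finitely generated and normally generated by `μ`, and let `ρ` be a representation of
`Γ` with commutative image such that `ρ μ` is close to the identity.  Then a crossed homomorphism
that is principal on `μ` is principal.  Indeed `Γ` is generated by finitely many conjugates
`x = w μ w⁻¹`, and if `z μ = 0` then `z x = (1 - ρ μ) (z w)`, which bounds the values of `z` on
these generators by a small multiple of themselves. -/
theorem exists_pos_forall_crossedHom_principal [Group.FG Γ] (μ : Γ)
    (hμ : Subgroup.normalClosure {μ} = ⊤) :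
    ∃ ε : ℝ, 0 < ε ∧ ∀ (V : Type) [AddCommGroup V] [Module ℂ V] (ρ : Representation ℂ Γ V)
      (p : Seminorm ℂ V) (z : Γ → V), (∀ v, p v = 0 → v = 0) → (∀ g h, Commute (ρ g) (ρ h)) →
      (∀ v, p (ρ μ v - v) ≤ ε * p v) → (∀ v, p (ρ μ⁻¹ v - v) ≤ ε * p v) → IsCrossedHom ρ z →
      (∃ v, z μ = ρ μ v - v) → ∃ v, ∀ g, z g = ρ g v - v := by
  obtain ⟨T, hTμ, hT⟩ := exists_finset_subset_closure_eq_top (Y := Group.conjugatesOfSet {μ}) hμ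
  have hconj : ∀ x : T, ∃ w : Γ, w * μ * w⁻¹ = x := by
    intro x
    have := hTμ x.2
    rw [Group.mem_conjugatesOfSet_iff] at this
    obtain ⟨a, ha, hax⟩ := this
    rw [Set.mem_singleton_iff] at ha
    exact isConj_iff.1 (ha ▸ hax)
  choose w hw using hconj
  choose C D hC hD H using exists_crossedHom_bound hT
  set M : ℝ := ∑ x : T, C (w x) with hM
  have hM0 : 0 ≤ M := Finset.sum_nonneg fun x _ => hC _
  refine ⟨1 / (M + 1), by positivity, ?_⟩
  set ε : ℝ := 1 / (M + 1) with hε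
  have hε0 : 0 < ε := by positivity
  have hε1 : ε ≤ 1 := by
    rw [hε, div_le_one (by positivity)]
    linarith
  have hεM : ε * M < 1 := by
    rw [hε, one_div, inv_mul_lt_iff₀ (by positivity)]
    linarith
  intro V _ _ ρ p z hp hcomm h₁ h₂ hz hzμ
  obtain ⟨v, hv⟩ := hzμ
  refine ⟨v, ?_⟩
  -- Subtracting a principal crossed homomorphism, assume that `z μ = 0`.
  set y : Γ → V := fun g => z g - (ρ g v - v) with hy
  have hyc : IsCrossedHom ρ y := hz.sub_principal v
  have hyμ : y μ = 0 := by simp [hy, hv]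
  suffices h : ∀ g, y g = 0 from fun g => sub_eq_zero.1 (h g)
  have hρ : ∀ x : T, ρ x = ρ μ := by
    intro x
    rw [← hw x, map_mul, map_mul, (hcomm (w x) μ).eq, mul_assoc, ← map_mul, mul_inv_cancel,
      map_one, mul_one]
  have hρ' : ∀ x : T, ρ (x : Γ)⁻¹ = ρ μ⁻¹ := by
    intro x
    rw [← hw x, mul_inv_rev, mul_inv_rev, inv_inv, map_mul, map_mul, (hcomm μ⁻¹ (w x)⁻¹).eq,
      ← mul_assoc, ← map_mul, mul_inv_cancel, map_one, one_mul]
  have hdouble : ∀ x ∈ (T : Set Γ), ∀ v, p (ρ x v) ≤ 2 * p v ∧ p (ρ x⁻¹ v) ≤ 2 * p v := by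
    intro x hx v
    have aux : ∀ u : V, p (u - v) ≤ ε * p v → p u ≤ 2 * p v := by
      intro u hu
      have h3 : p u ≤ p (u - v) + p v := by
        simpa using map_add_le_add p (u - v) v
      nlinarith [apply_nonneg p v]
    refine ⟨aux _ ?_, aux _ ?_⟩
    · rw [hρ ⟨x, hx⟩]
      exact h₁ v
    · rw [hρ' ⟨x, hx⟩]
      exact h₂ v
  have hx0 : ∀ x ∈ (T : Set Γ), p (y x) ≤ 0 := by
    rcases T.eq_empty_or_nonempty with hTe | hTne
    · simp [hTe]
    obtain ⟨x, hxT, hx⟩ := Finset.exists_max_image T (fun x => p (y x)) hTne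
    have hle := (H (w ⟨x, hxT⟩) V ρ p y (p (y x)) hyc hdouble hx).2.2
    have hyx : y x = -(ρ μ (y (w ⟨x, hxT⟩)) - y (w ⟨x, hxT⟩)) := by
      have := hyc.map_conj (w ⟨x, hxT⟩) μ
      rw [hyμ, map_zero, add_zero, hw, hρ] at this
      rw [this]
      abel
    have hCM : C (w ⟨x, hxT⟩) ≤ M :=
      Finset.single_le_sum (f := fun x : T => C (w x)) (fun x _ => hC _) (Finset.mem_univ _)
    have hle2 : p (y x) ≤ ε * M * p (y x) := by
      calc p (y x) ≤ ε * p (y (w ⟨x, hxT⟩)) := by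
            conv_lhs => rw [hyx, map_neg_eq_map]
            exact h₁ _
        _ ≤ ε * (M * p (y x)) := by
            refine mul_le_mul_of_nonneg_left (hle.trans ?_) hε0.le
            exact mul_le_mul_of_nonneg_right hCM (apply_nonneg p _)
        _ = ε * M * p (y x) := by ring
    have hx0 : p (y x) ≤ 0 := by
      nlinarith [apply_nonneg p (y x)]
    exact fun x' hx' => (hx x' hx').trans hx0
  intro g
  have := (H g V ρ p y 0 hyc hdouble hx0).2.2
  rw [mul_zero] at this
  exact hp _ (le_antisymm this (apply_nonneg p _))

end CrossedHom

/-! ### Twisted one-cocycles as functions of paths -/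

namespace TwistedCohomology

variable {X : Type*} [TopologicalSpace X] {x₀ : X}
variable {V : Type*} [AddCommGroup V] [Module ℂ V]

/-- A path, as a singular `1`-simplex. -/
def pathSimplex {x y : X} (γ : Path x y) : C(Simplex 1, X) :=
  γ.toContinuousMap.comp ⟨stdSimplexHomeomorphUnitInterval, by fun_prop⟩

theorem pathSimplex_vertex_zero {x y : X} (γ : Path x y) :
    pathSimplex γ (stdSimplex.vertex 0) = x := by
  have h : stdSimplexHomeomorphUnitInterval (stdSimplex.vertex 0) = 0 :=
    stdSimplexHomeomorphUnitInterval_zero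
  simp [pathSimplex, h]

/-- The `1`-simplex of the universal cover over the path `γ` that starts at the point given by the
class `q`. -/
def liftedPath {x y : X} (q : Path.Homotopic.Quotient x₀ x) (γ : Path x y) :
    LiftedSimplex x₀ 1 :=
  ⟨pathSimplex γ, q.cast rfl (pathSimplex_vertex_zero γ)⟩

theorem liftedSimplex_ext {n : ℕ} {s s' : LiftedSimplex x₀ n} (h : s.1 = s'.1)
    (h' : s.2 = s'.2.cast rfl (by rw [h])) : s = s' := by
  obtain ⟨σ, q⟩ := s
  obtain ⟨σ', q'⟩ := s'
  obtain rfl : σ = σ' := h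
  simpa using h'

theorem simplexEdge_apply {n : ℕ} (i j : Fin (n + 1)) (t : unitInterval) (k : Fin (n + 1)) :
    (simplexEdge i j t).1 k =
      (1 - (t : ℝ)) * (Pi.single i 1 : Fin (n + 1) → ℝ) k +
        t * (Pi.single j 1 : Fin (n + 1) → ℝ) k := by
  change AffineMap.lineMap (Pi.single i 1 : Fin (n + 1) → ℝ) (Pi.single j 1) (t : ℝ) k = _
  simp [AffineMap.lineMap_apply]
  ring

theorem face_two_eq_pathSimplex (i : Fin 3) (f : C(Simplex 2, X)) :
    face i f =
      pathSimplex ((simplexEdge (i.succAbove 0) (i.succAbove 1)).map f.continuous) := by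
  ext p
  change f _ = f _
  congr 1
  apply Subtype.ext
  ext k
  rw [simplexEdge_apply]
  have h1 : ((stdSimplexHomeomorphUnitInterval p : unitInterval) : ℝ) = p.1 1 := rfl
  have h0 : p.1 0 = 1 - p.1 1 := by
    have := p.2.2
    rw [Fin.sum_univ_two] at this
    linarith
  change stdSimplex.map i.succAbove p k = _
  rw [stdSimplex.map_coe]
  change FunOnFinite.linearMap ℝ ℝ i.succAbove p.1 k = _
  rw [ContinuousMap.coe_mk, FunOnFinite.linearMap_apply_apply, h1, Finset.sum_filter,
    Fin.sum_univ_two, h0]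
  simp [Pi.single_apply, eq_comm]

theorem eq_liftedPath (σ : C(Simplex 1, X))
    (q : Path.Homotopic.Quotient x₀ (σ (stdSimplex.vertex 0))) :
    (⟨σ, q⟩ : LiftedSimplex x₀ 1) = liftedPath q ((simplexEdge 0 1).map σ.continuous) := by
  refine liftedSimplex_ext ?_ (by
    obtain ⟨r, rfl⟩ := Path.Homotopic.Quotient.mk_surjective q
    rfl)
  ext p
  change σ _ = σ _
  congr 1
  apply Subtype.ext
  ext k
  rw [simplexEdge_apply]
  have h1 : ((stdSimplexHomeomorphUnitInterval p : unitInterval) : ℝ) = p.1 1 := rfl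
  have h0 : p.1 0 = 1 - p.1 1 := by
    have := p.2.2
    rw [Fin.sum_univ_two] at this
    linarith
  rw [ContinuousMap.coe_mk, h1, ← h0]
  fin_cases k <;> simp

/-- The vertex of the universal cover given by a class of paths. -/
def liftedPoint {x : X} (q : Path.Homotopic.Quotient x₀ x) : LiftedSimplex x₀ 0 :=
  ⟨ContinuousMap.const _ x, q⟩

theorem eq_liftedPoint (s : LiftedSimplex x₀ 0) : s = liftedPoint s.2 := by
  refine liftedSimplex_ext ?_ (by simp [liftedPoint])
  ext p
  exact congrArg s.1 (Subsingleton.elim _ _)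

theorem act_liftedPoint {x : X} (q : Path.Homotopic.Quotient x₀ x) (g : FundamentalGroup X x₀) :
    act (liftedPoint q) g = liftedPoint (g.toPath.trans q) := rfl

theorem simplexEdge_self {n : ℕ} (i : Fin (n + 1)) :
    simplexEdge i i = Path.refl (stdSimplex.vertex i : Simplex n) := by
  ext t k
  change (simplexEdge i i t).1 k = _
  rw [simplexEdge_apply]
  change _ = (Pi.single i 1 : Fin (n + 1) → ℝ) k
  ring

theorem liftedFace_zero_eq (f : C(Simplex 2, X))
    (q : Path.Homotopic.Quotient x₀ (f (stdSimplex.vertex 0))) :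
    liftedFace 0 ⟨f, q⟩ =
      liftedPath (q.trans (.mk ((simplexEdge 0 1).map f.continuous)))
        ((simplexEdge 1 2).map f.continuous) := by
  refine liftedSimplex_ext (face_two_eq_pathSimplex 0 f) ?_
  induction q using Path.Homotopic.Quotient.ind with | mk r => ?_
  rfl

theorem liftedFace_one_eq (f : C(Simplex 2, X))
    (q : Path.Homotopic.Quotient x₀ (f (stdSimplex.vertex 0))) :
    liftedFace 1 ⟨f, q⟩ = liftedPath q ((simplexEdge 0 2).map f.continuous) := by
  have h : liftedFace 1 ⟨f, q⟩ =
      liftedPath (q.trans (.mk ((simplexEdge 0 0).map f.continuous)))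
        ((simplexEdge 0 2).map f.continuous) := by
    refine liftedSimplex_ext (face_two_eq_pathSimplex 1 f) ?_
    induction q using Path.Homotopic.Quotient.ind with | mk r => ?_
    rfl
  rw [h, simplexEdge_self]
  exact congrArg (fun q' => liftedPath q' _) (Path.Homotopic.Quotient.trans_refl q)

theorem liftedFace_two_eq (f : C(Simplex 2, X))
    (q : Path.Homotopic.Quotient x₀ (f (stdSimplex.vertex 0))) :
    liftedFace 2 ⟨f, q⟩ = liftedPath q ((simplexEdge 0 1).map f.continuous) := by
  have h : liftedFace 2 ⟨f, q⟩ =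
      liftedPath (q.trans (.mk ((simplexEdge 0 0).map f.continuous)))
        ((simplexEdge 0 1).map f.continuous) := by
    refine liftedSimplex_ext (face_two_eq_pathSimplex 2 f) ?_
    induction q using Path.Homotopic.Quotient.ind with | mk r => ?_
    rfl
  rw [h, simplexEdge_self]
  exact congrArg (fun q' => liftedPath q' _) (Path.Homotopic.Quotient.trans_refl q)

theorem path_trans_apply_congr {a b c a' b' c' : X} {p : Path a b} {q : Path b c}
    {p' : Path a' b'} {q' : Path b' c'} (hp : ∀ t, p t = p' t) (hq : ∀ t, q t = q' t)
    (t : unitInterval) : p.trans q t = p'.trans q' t := by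
  simp only [Path.trans_apply, hp, hq]

theorem liftedFace_zero_liftedPath {x y : X} (q : Path.Homotopic.Quotient x₀ x) (γ : Path x y) :
    liftedFace 0 (liftedPath q γ) = liftedPoint (q.trans (.mk γ)) := by
  have hv : stdSimplexHomeomorphUnitInterval (stdSimplex.vertex 1) = 1 :=
    stdSimplexHomeomorphUnitInterval_one
  have hm (p : Simplex 0) : stdSimplex.map (Fin.succAbove 0) p =
      (stdSimplex.vertex 1 : Simplex 1) := by
    rw [Subsingleton.elim p (stdSimplex.vertex 0), stdSimplex.map_vertex]
    rfl
  refine liftedSimplex_ext ?_ ?_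
  · ext p
    change γ (stdSimplexHomeomorphUnitInterval (stdSimplex.map _ p)) = y
    rw [hm, hv, γ.target]
  · obtain ⟨r, rfl⟩ := Path.Homotopic.Quotient.mk_surjective q
    change Path.Homotopic.Quotient.mk _ = Path.Homotopic.Quotient.mk _
    congr 1
    ext t
    refine path_trans_apply_congr (p := r.cast rfl (pathSimplex_vertex_zero γ))
      (q := edge 0 (pathSimplex γ)) (p' := r) (q' := γ) (fun _ => rfl) (fun t => ?_) t
    change γ _ = γ _
    congr 1
    apply Subtype.ext
    change (simplexEdge _ _ _).1 1 = _
    rw [simplexEdge_apply]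
    simp

theorem liftedFace_one_liftedPath {x y : X} (q : Path.Homotopic.Quotient x₀ x) (γ : Path x y) :
    liftedFace 1 (liftedPath q γ) = liftedPoint q := by
  have hv : stdSimplexHomeomorphUnitInterval (stdSimplex.vertex 0) = 0 :=
    stdSimplexHomeomorphUnitInterval_zero
  have hm (p : Simplex 0) : stdSimplex.map (Fin.succAbove 1) p =
      (stdSimplex.vertex 0 : Simplex 1) := by
    rw [Subsingleton.elim p (stdSimplex.vertex 0), stdSimplex.map_vertex]
    rfl
  rw [← Path.Homotopic.Quotient.trans_refl q]
  refine liftedSimplex_ext ?_ ?_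
  · ext p
    change γ (stdSimplexHomeomorphUnitInterval (stdSimplex.map _ p)) = x
    rw [hm, hv, γ.source]
  · obtain ⟨r, rfl⟩ := Path.Homotopic.Quotient.mk_surjective q
    rw [Path.Homotopic.Quotient.trans_refl]
    conv_rhs => rw [← Path.Homotopic.Quotient.trans_refl (.mk r)]
    change Path.Homotopic.Quotient.mk _ = Path.Homotopic.Quotient.mk _
    congr 1
    ext t
    refine path_trans_apply_congr (p := r.cast rfl (pathSimplex_vertex_zero γ))
      (q := edge 1 (pathSimplex γ)) (p' := r) (q' := Path.refl x) (fun _ => rfl) (fun t => ?_) t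
    refine Eq.trans ?_ γ.source
    change γ _ = γ _
    congr 1
    apply Subtype.ext
    change (simplexEdge _ _ _).1 1 = _
    rw [simplexEdge_apply]
    simp

variable {ρ : Representation ℂ (FundamentalGroup X x₀) V}

theorem coboundary_liftedPath (b : cochains ρ 0) {x y : X} (q : Path.Homotopic.Quotient x₀ x)
    (γ : Path x y) : (coboundary ρ 0 b).1 (liftedPath q γ) =
      b.1 (liftedPoint (q.trans (.mk γ))) - b.1 (liftedPoint q) := by
  change ∑ i : Fin 2, (-1 : ℂ) ^ (i : ℕ) • b.1 (liftedFace i (liftedPath q γ)) = _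
  rw [Fin.sum_univ_two, liftedFace_zero_liftedPath, liftedFace_one_liftedPath]
  simp [sub_eq_add_neg]

section Cocycle

variable {c : cochains ρ 1} (hc : c ∈ cocycles ρ 1)

include hc

/-- The cocycle condition for a singular triangle with prescribed edges. -/
theorem cocycle_triangle {x y z : X} (q : Path.Homotopic.Quotient x₀ x) (γ : Path x y)
    (δ : Path y z) (ε : Path x z) (f : C(Simplex 2, X)) (hγ : ∀ t, f (simplexEdge 0 1 t) = γ t)
    (hδ : ∀ t, f (simplexEdge 1 2 t) = δ t) (hε : ∀ t, f (simplexEdge 0 2 t) = ε t) :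
    c.1 (liftedPath q ε) = c.1 (liftedPath q γ) + c.1 (liftedPath (q.trans (.mk γ)) δ) := by
  obtain rfl : f (stdSimplex.vertex 0) = x := by simpa using hγ 0
  obtain rfl : f (stdSimplex.vertex 1) = y := by simpa using hγ 1
  obtain rfl : f (stdSimplex.vertex 2) = z := by simpa using hδ 1
  obtain rfl : (simplexEdge 0 1).map f.continuous = γ := by ext t; exact hγ t
  obtain rfl : (simplexEdge 1 2).map f.continuous = δ := by ext t; exact hδ t
  obtain rfl : (simplexEdge 0 2).map f.continuous = ε := by ext t; exact hε t
  have h : (coboundary ρ 1 c).1 ⟨f, q⟩ = 0 := by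
    have : coboundary ρ 1 c = 0 := hc
    rw [this]
    rfl
  change ∑ i : Fin 3, (-1 : ℂ) ^ (i : ℕ) • c.1 (liftedFace i ⟨f, q⟩) = 0 at h
  rw [Fin.sum_univ_three, liftedFace_zero_eq, liftedFace_one_eq, liftedFace_two_eq] at h
  simp only [Fin.val_zero, Fin.val_one, Fin.val_two, pow_zero, pow_one, one_smul, neg_smul,
    even_two, Even.neg_pow, one_pow] at h
  rw [← sub_eq_zero, ← neg_eq_zero, ← h]
  abel

theorem cocycle_refl {x : X} (q : Path.Homotopic.Quotient x₀ x) :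
    c.1 (liftedPath q (Path.refl x)) = 0 := by
  have h := cocycle_triangle hc q (Path.refl x) (Path.refl x) (Path.refl x)
    (ContinuousMap.const _ x) (fun _ => rfl) (fun _ => rfl) (fun _ => rfl)
  rw [Path.Homotopic.Quotient.mk_refl, Path.Homotopic.Quotient.trans_refl] at h
  simpa using h

theorem cocycle_homotopic {x y : X} (q : Path.Homotopic.Quotient x₀ x) {γ γ' : Path x y}
    (h : γ.Homotopic γ') : c.1 (liftedPath q γ) = c.1 (liftedPath q γ') := by
  obtain ⟨F⟩ := h
  -- The square `F` is cut into two triangles along its diagonal.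
  have hsum : ∀ a : Simplex 2, a.1 1 + a.1 2 ∈ unitInterval := fun a => by
    have h := a.2.2
    rw [Fin.sum_univ_three] at h
    exact ⟨add_nonneg (a.2.1 1) (a.2.1 2), by linarith [a.2.1 0]⟩
  have hpr : ∀ a : Simplex 2, a.1 2 ∈ unitInterval := fun a =>
    ⟨a.2.1 2, (le_add_of_nonneg_left (a.2.1 1)).trans (hsum a).2⟩
  have c1 : Continuous fun a : Simplex 2 => (⟨_, hsum a⟩ : unitInterval) :=
    Continuous.subtype_mk (((continuous_apply 1).comp continuous_subtype_val).add
      ((continuous_apply 2).comp continuous_subtype_val)) _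
  have c2 : Continuous fun a : Simplex 2 => (⟨_, hpr a⟩ : unitInterval) :=
    Continuous.subtype_mk ((continuous_apply 2).comp continuous_subtype_val) _
  let d : Path x y := ⟨⟨fun t => F (t, t), by fun_prop⟩, by simp, by simp⟩
  have e₁ : ∀ (i j : Fin 3) (t : unitInterval),
      (⟨_, hsum (simplexEdge i j t)⟩ : unitInterval).1 =
        ((1 - (t : ℝ)) * (Pi.single i 1 : Fin 3 → ℝ) 1 + t * (Pi.single j 1 : Fin 3 → ℝ) 1) +
        ((1 - (t : ℝ)) * (Pi.single i 1 : Fin 3 → ℝ) 2 + t * (Pi.single j 1 : Fin 3 → ℝ) 2) := by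
    intro i j t
    rw [← simplexEdge_apply, ← simplexEdge_apply]
  have e₂ : ∀ (i j : Fin 3) (t : unitInterval),
      (⟨_, hpr (simplexEdge i j t)⟩ : unitInterval).1 =
        (1 - (t : ℝ)) * (Pi.single i 1 : Fin 3 → ℝ) 2 + t * (Pi.single j 1 : Fin 3 → ℝ) 2 := by
    intro i j t
    rw [← simplexEdge_apply]
  have h₁ := cocycle_triangle hc q γ (Path.refl y) d
    ⟨fun a => F (⟨_, hpr a⟩, ⟨_, hsum a⟩), by fun_prop⟩
    (fun t => by
      have a1 : (⟨_, hsum (simplexEdge 0 1 t)⟩ : unitInterval) = t := Subtype.ext (by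
        rw [e₁]; simp)
      have a2 : (⟨_, hpr (simplexEdge 0 1 t)⟩ : unitInterval) = 0 := Subtype.ext (by
        rw [e₂]; simp)
      simp only [ContinuousMap.coe_mk, a1, a2]
      simp)
    (fun t => by
      have a1 : (⟨_, hsum (simplexEdge 1 2 t)⟩ : unitInterval) = 1 := Subtype.ext (by
        rw [e₁]; simp)
      simp only [ContinuousMap.coe_mk, a1]
      simp)
    (fun t => by
      have a1 : (⟨_, hsum (simplexEdge 0 2 t)⟩ : unitInterval) = t := Subtype.ext (by
        rw [e₁]; simp)
      have a2 : (⟨_, hpr (simplexEdge 0 2 t)⟩ : unitInterval) = t := Subtype.ext (by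
        rw [e₂]; simp)
      simp only [ContinuousMap.coe_mk, a1, a2]
      rfl)
  have h₂ := cocycle_triangle hc q (Path.refl x) γ' d
    ⟨fun a => F (⟨_, hsum a⟩, ⟨_, hpr a⟩), by fun_prop⟩
    (fun t => by
      have a2 : (⟨_, hpr (simplexEdge 0 1 t)⟩ : unitInterval) = 0 := Subtype.ext (by
        rw [e₂]; simp)
      simp only [ContinuousMap.coe_mk, a2]
      simp)
    (fun t => by
      have a1 : (⟨_, hsum (simplexEdge 1 2 t)⟩ : unitInterval) = 1 := Subtype.ext (by
        rw [e₁]; simp)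
      have a2 : (⟨_, hpr (simplexEdge 1 2 t)⟩ : unitInterval) = t := Subtype.ext (by
        rw [e₂]; simp)
      simp only [ContinuousMap.coe_mk, a1, a2]
      simp)
    (fun t => by
      have a1 : (⟨_, hsum (simplexEdge 0 2 t)⟩ : unitInterval) = t := Subtype.ext (by
        rw [e₁]; simp)
      have a2 : (⟨_, hpr (simplexEdge 0 2 t)⟩ : unitInterval) = t := Subtype.ext (by
        rw [e₂]; simp)
      simp only [ContinuousMap.coe_mk, a1, a2]
      rfl)
  rw [cocycle_refl hc, add_zero] at h₁
  rw [cocycle_refl hc, zero_add, Path.Homotopic.Quotient.mk_refl,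
    Path.Homotopic.Quotient.trans_refl] at h₂
  rw [← h₁, h₂]

theorem cocycle_trans {x y z : X} (q : Path.Homotopic.Quotient x₀ x) (γ : Path x y)
    (δ : Path y z) :
    c.1 (liftedPath q (γ.trans δ)) =
      c.1 (liftedPath q γ) + c.1 (liftedPath (q.trans (.mk γ)) δ) := by
  -- The triangle is projected affinely onto the unit interval, with its vertices going to `0`,
  -- `1 / 2` and `1`.
  have hsum : ∀ a : Simplex 2, a.1 1 / 2 + a.1 2 ∈ unitInterval := fun a => by
    have h := a.2.2
    rw [Fin.sum_univ_three] at h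
    have h0 := a.2.1 0
    have h1 := a.2.1 1
    have h2 := a.2.1 2
    exact ⟨by positivity, by linarith⟩
  have c1 : Continuous fun a : Simplex 2 => (⟨_, hsum a⟩ : unitInterval) :=
    Continuous.subtype_mk ((((continuous_apply 1).comp continuous_subtype_val).div_const 2).add
      ((continuous_apply 2).comp continuous_subtype_val)) _
  have e₁ : ∀ (i j : Fin 3) (t : unitInterval),
      (⟨_, hsum (simplexEdge i j t)⟩ : unitInterval).1 =
        ((1 - (t : ℝ)) * (Pi.single i 1 : Fin 3 → ℝ) 1 +
          t * (Pi.single j 1 : Fin 3 → ℝ) 1) / 2 +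
        ((1 - (t : ℝ)) * (Pi.single i 1 : Fin 3 → ℝ) 2 + t * (Pi.single j 1 : Fin 3 → ℝ) 2) := by
    intro i j t
    rw [← simplexEdge_apply, ← simplexEdge_apply]
  refine cocycle_triangle hc q γ δ (γ.trans δ) ⟨fun a => γ.trans δ ⟨_, hsum a⟩, by fun_prop⟩
    (fun t => ?_) (fun t => ?_) (fun t => ?_)
  · have a1 : (⟨_, hsum (simplexEdge 0 1 t)⟩ : unitInterval).1 = t / 2 := by
      rw [e₁]; simp
    simp only [ContinuousMap.coe_mk]
    rw [Path.trans_apply, dif_pos (by rw [a1]; linarith [t.2.2])]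
    congr 1
    apply Subtype.ext
    change 2 * (⟨_, hsum (simplexEdge 0 1 t)⟩ : unitInterval).1 = t
    rw [a1]
    ring
  · have a1 : (⟨_, hsum (simplexEdge 1 2 t)⟩ : unitInterval).1 = (1 + t) / 2 := by
      rw [e₁]; simp; ring
    simp only [ContinuousMap.coe_mk]
    rcases eq_or_ne t 0 with rfl | ht
    · have a2 : (⟨_, hsum (simplexEdge 1 2 0)⟩ : unitInterval).1 = 1 / 2 := by
        rw [a1]; simp
      rw [Path.trans_apply, dif_pos a2.le]
      have : (⟨2 * (⟨_, hsum (simplexEdge 1 2 0)⟩ : unitInterval).1,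
          (unitInterval.mul_pos_mem_iff zero_lt_two).2 ⟨(hsum _).1, a2.le⟩⟩ : unitInterval) = 1 :=
        Subtype.ext (by
          change 2 * (⟨_, hsum (simplexEdge 1 2 0)⟩ : unitInterval).1 = 1
          rw [a2]
          norm_num)
      rw [this]
      simp
    have ht0 : (0 : ℝ) < t := lt_of_le_of_ne t.2.1 fun h => ht (Subtype.ext h.symm)
    rw [Path.trans_apply, dif_neg (by rw [a1]; push Not; linarith)]
    congr 1
    apply Subtype.ext
    change 2 * (⟨_, hsum (simplexEdge 1 2 t)⟩ : unitInterval).1 - 1 = t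
    rw [a1]
    ring
  · have a1 : (⟨_, hsum (simplexEdge 0 2 t)⟩ : unitInterval) = t := Subtype.ext (by
      rw [e₁]; simp)
    simp only [ContinuousMap.coe_mk, a1]

/-- The value of a cocycle on a class of paths out of the basepoint of the universal cover. -/
theorem exists_cocycle_value :
    ∃ Z : ∀ x : X, Path.Homotopic.Quotient x₀ x → V,
      (∀ x (γ : Path x₀ x), Z x (.mk γ) = c.1 (liftedPath (.refl x₀) γ)) ∧
      (∀ x (g : FundamentalGroup X x₀) (q : Path.Homotopic.Quotient x₀ x),
        Z x (g.toPath.trans q) = Z x₀ g.toPath + ρ g⁻¹ (Z x q)) ∧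
      ∀ x y (q : Path.Homotopic.Quotient x₀ x) (γ : Path x y),
        c.1 (liftedPath q γ) = Z y (q.trans (.mk γ)) - Z x q := by
  have hact : ∀ {x y : X} (g : FundamentalGroup X x₀) (q : Path.Homotopic.Quotient x₀ x)
      (γ : Path x y), c.1 (liftedPath (g.toPath.trans q) γ) = ρ g⁻¹ (c.1 (liftedPath q γ)) := by
    intro x y g q γ
    refine (congrArg c.1 (?_ : _ = act (liftedPath q γ) g)).trans (c.2 _ _)
    refine liftedSimplex_ext rfl ?_
    obtain ⟨q, rfl⟩ := Path.Homotopic.Quotient.mk_surjective q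
    induction g using Path.Homotopic.Quotient.ind with | mk r => ?_
    rfl
  let Z : ∀ x : X, Path.Homotopic.Quotient x₀ x → V := fun x =>
    Quotient.lift (fun γ => c.1 (liftedPath (.refl x₀) γ)) fun γ γ' h => cocycle_homotopic hc _ h
  have hZ : ∀ x (γ : Path x₀ x), Z x (.mk γ) = c.1 (liftedPath (.refl x₀) γ) := fun _ _ => rfl
  have hZt : ∀ {x y : X} (γ : Path x₀ x) (δ : Path x y), Z y (.mk (γ.trans δ)) =
      Z x (.mk γ) + c.1 (liftedPath (.mk γ) δ) := by
    intro x y γ δ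
    rw [hZ, hZ, cocycle_trans hc, Path.Homotopic.Quotient.refl_trans]
  refine ⟨Z, hZ, fun x g q => ?_, fun x y q γ => ?_⟩
  · obtain ⟨δ, rfl⟩ := Path.Homotopic.Quotient.mk_surjective q
    obtain ⟨γ, hγ⟩ := Path.Homotopic.Quotient.mk_surjective g.toPath
    rw [← hγ, ← Path.Homotopic.Quotient.mk_trans, hZt, hZ x δ, hγ]
    congr 1
    conv_lhs => rw [← Path.Homotopic.Quotient.trans_refl g.toPath]
    exact hact g _ δ
  · obtain ⟨r, rfl⟩ := Path.Homotopic.Quotient.mk_surjective q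
    rw [← Path.Homotopic.Quotient.mk_trans, hZt]
    simp

/-- A cocycle determines a crossed homomorphism of the fundamental group, by its values on loops.
If the crossed homomorphism is principal, then the cocycle is a coboundary. -/
theorem exists_crossedHom_of_cocycle :
    ∃ y : FundamentalGroup X x₀ → V, IsCrossedHom ρ y ∧
      (∀ γ : Path x₀ x₀, y (FundamentalGroup.fromPath (.mk γ))⁻¹ =
        c.1 (liftedPath (.refl x₀) γ)) ∧
      ((∃ v, ∀ g, y g = ρ g v - v) → c ∈ coboundaries ρ 1) := by
  obtain ⟨Z, hZ, hZact, hZc⟩ := exists_cocycle_value hc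
  refine ⟨fun g => Z x₀ (g⁻¹).toPath, fun g h => ?_, fun γ => ?_, ?_⟩
  · have := hZact x₀ g⁻¹ (h⁻¹).toPath
    rw [inv_inv] at this
    beta_reduce
    rw [← this, mul_inv_rev]
    rfl
  · beta_reduce
    rw [inv_inv]
    exact hZ _ _
  · rintro ⟨v, hv⟩
    have hv' : ∀ g : FundamentalGroup X x₀, Z x₀ g.toPath = ρ g⁻¹ v - v := fun g => by
      have := hv g⁻¹
      beta_reduce at this
      rwa [inv_inv] at this
    refine ⟨⟨fun s => Z _ s.2 + v, fun s g => ?_⟩, ?_⟩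
    · change Z _ (g.toPath.trans s.2) + v = _
      rw [hZact, hv', map_add]
      abel
    · apply Subtype.ext
      funext ⟨σ, q⟩
      rw [eq_liftedPath, coboundary_liftedPath, hZc]
      simp [liftedPoint]

end Cocycle

theorem liftedMap_liftedPath {Y : Type*} [TopologicalSpace Y] (f : C(Y, X)) (y₀ : Y) {x y : Y}
    (q : Path.Homotopic.Quotient y₀ x) (γ : Path x y) :
    liftedMap f y₀ (liftedPath q γ) = liftedPath (q.map f) (γ.map f.continuous) := by
  refine liftedSimplex_ext rfl ?_
  obtain ⟨r, rfl⟩ := Path.Homotopic.Quotient.mk_surjective q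
  rfl

/-- If a class in `H¹(X; ρ)` vanishes on `Y`, then its crossed homomorphism is principal on each
loop of `Y`. -/
theorem exists_liftedPath_map_eq_of_mem_ker {Y : Type*} [TopologicalSpace Y] (f : C(Y, X)) (y₀ : Y)
    {ρ : Representation ℂ (FundamentalGroup X (f y₀)) V} {c : cochains ρ 1}
    (hc : cochainMap f y₀ ρ 1 c ∈ coboundaries (pullbackRep f y₀ ρ) 1) (γ : Path y₀ y₀) :
    ∃ v, c.1 (liftedPath (.refl (f y₀)) (γ.map f.continuous)) =
      ρ (FundamentalGroup.map f y₀ (FundamentalGroup.fromPath (.mk γ)))⁻¹ v - v := by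
  obtain ⟨b, hb⟩ := hc
  refine ⟨b.1 (liftedPoint (.refl y₀)), ?_⟩
  have h := congrArg (fun c => c.1 (liftedPath (.refl y₀) γ)) hb
  beta_reduce at h
  rw [coboundary_liftedPath, Path.Homotopic.Quotient.refl_trans,
    ← Path.Homotopic.Quotient.trans_refl (.mk γ)] at h
  have h2 := b.2 (liftedPoint (.refl y₀)) (FundamentalGroup.fromPath (.mk γ))
  rw [act_liftedPoint] at h2
  rw [show b.1 (liftedPoint ((Path.Homotopic.Quotient.mk γ).trans (.refl y₀))) = _ from h2] at h
  change _ = c.1 (liftedMap f y₀ (liftedPath (.refl y₀) γ)) at h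
  rw [liftedMap_liftedPath] at h
  rw [← map_inv]
  exact h.symm

/-- `H⁰(X; ρ)` is the space of invariants of `ρ`, by evaluation at the basepoint. -/
theorem nonempty_H_zero_equiv_invariants (ρ : Representation ℂ (FundamentalGroup X x₀) V) :
    Nonempty (H ρ 0 ≃ₗ[ℂ] ρ.invariants) := by
  have hconst : ∀ b ∈ cocycles ρ 0, ∀ {x : X} (q : Path.Homotopic.Quotient x₀ x),
      b.1 (liftedPoint q) = b.1 (liftedPoint (.refl x₀)) := by
    intro b hb x q
    obtain ⟨γ, rfl⟩ := Path.Homotopic.Quotient.mk_surjective q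
    have hb : coboundary ρ 0 b = 0 := hb
    have h := coboundary_liftedPath b (.refl x₀) γ
    rw [hb, Path.Homotopic.Quotient.refl_trans] at h
    exact sub_eq_zero.1 h.symm
  let ev : cocycles ρ 0 →ₗ[ℂ] ρ.invariants :=
    { toFun := fun b => ⟨b.1.1 (liftedPoint (.refl x₀)), fun g => by
        have h := b.1.2 (liftedPoint (.refl x₀)) g⁻¹
        rw [act_liftedPoint, hconst _ b.2, inv_inv] at h
        exact h.symm⟩
      map_add' := fun _ _ => rfl
      map_smul' := fun _ _ => rfl }
  have hev : Function.Bijective ev := by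
    constructor
    · rw [← LinearMap.ker_eq_bot, LinearMap.ker_eq_bot']
      intro b hb
      have hb : b.1.1 (liftedPoint (.refl x₀)) = 0 := congrArg Subtype.val hb
      apply Subtype.ext
      apply Subtype.ext
      funext s
      rw [eq_liftedPoint s, hconst _ b.2, hb]
      rfl
    · intro ⟨v, hv⟩
      refine ⟨⟨⟨fun _ => v, fun _ g => (hv g⁻¹).symm⟩, ?_⟩, rfl⟩
      change coboundary ρ 0 _ = 0
      apply Subtype.ext
      funext ⟨σ, q⟩
      rw [eq_liftedPath, coboundary_liftedPath]
      simp
  have hbot : (coboundaries ρ 0).submoduleOf (cocycles ρ 0) = ⊥ := by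
    rw [eq_bot_iff]
    intro b hb
    exact Subtype.ext hb
  exact ⟨(Submodule.quotEquivOfEqBot _ hbot).trans (LinearEquiv.ofBijective ev hev)⟩

end TwistedCohomology

/-! ### The adjoint representation near the center, and its invariants -/

section Adjoint

/-- The sum of the absolute values of the entries, a submultiplicative norm on `2 × 2` matrices. -/
noncomputable def entrySum (X : Matrix (Fin 2) (Fin 2) ℂ) : ℝ := ∑ i, ∑ j, ‖X i j‖

theorem entrySum_nonneg (X : Matrix (Fin 2) (Fin 2) ℂ) : 0 ≤ entrySum X :=
  Finset.sum_nonneg fun _ _ => Finset.sum_nonneg fun _ _ => norm_nonneg _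

theorem entrySum_add_le (X Y : Matrix (Fin 2) (Fin 2) ℂ) :
    entrySum (X + Y) ≤ entrySum X + entrySum Y := by
  simp only [entrySum, ← Finset.sum_add_distrib]
  exact Finset.sum_le_sum fun i _ => Finset.sum_le_sum fun j _ => norm_add_le _ _

theorem entrySum_neg (X : Matrix (Fin 2) (Fin 2) ℂ) : entrySum (-X) = entrySum X := by
  simp [entrySum]

theorem entrySum_mul_le (X Y : Matrix (Fin 2) (Fin 2) ℂ) :
    entrySum (X * Y) ≤ entrySum X * entrySum Y := by
  have h : ∀ i j, ‖(X * Y) i j‖ ≤ ‖X i 0‖ * ‖Y 0 j‖ + ‖X i 1‖ * ‖Y 1 j‖ := by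
    intro i j
    rw [Matrix.mul_apply, Fin.sum_univ_two, ← norm_mul, ← norm_mul]
    exact norm_add_le _ _
  simp only [entrySum, Fin.sum_univ_two]
  have h00 := h 0 0
  have h01 := h 0 1
  have h10 := h 1 0
  have h11 := h 1 1
  have p : ∀ (i j k l : Fin 2), 0 ≤ ‖X i j‖ * ‖Y k l‖ := fun i j k l => by positivity
  nlinarith [p 0 0 1 0, p 0 0 1 1, p 0 1 0 0, p 0 1 0 1, p 1 0 1 0, p 1 0 1 1, p 1 1 0 0,
    p 1 1 0 1]

theorem continuous_entrySum : Continuous entrySum := by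
  unfold entrySum
  fun_prop

/-- The seminorm on `sl₂(ℂ)` given by the sum of the absolute values of the entries. -/
noncomputable def sl2Seminorm : Seminorm ℂ SL2LieAlgebra :=
  Seminorm.of (fun X => entrySum X.1) (fun X Y => entrySum_add_le X.1 Y.1) (fun r X => by
    change entrySum (r • X.1) = ‖r‖ * entrySum X.1
    simp [entrySum]
    ring)

theorem sl2Seminorm_apply (X : SL2LieAlgebra) : sl2Seminorm X = entrySum X.1 := rfl

theorem eq_zero_of_entrySum_eq_zero {X : Matrix (Fin 2) (Fin 2) ℂ} (h : entrySum X = 0) :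
    X = 0 := by
  ext i j
  have hi := (Finset.sum_eq_zero_iff_of_nonneg (f := fun i => ∑ j, ‖X i j‖)
    fun _ _ => Finset.sum_nonneg fun _ _ => norm_nonneg _).1 h i (Finset.mem_univ _)
  have hj := (Finset.sum_eq_zero_iff_of_nonneg (f := fun j => ‖X i j‖)
    fun _ _ => norm_nonneg _).1 hi j (Finset.mem_univ _)
  exact norm_eq_zero.1 hj

theorem eq_zero_of_sl2Seminorm_eq_zero (X : SL2LieAlgebra) (h : sl2Seminorm X = 0) : X = 0 :=
  Subtype.ext (eq_zero_of_entrySum_eq_zero h)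

theorem adjointRep_apply_coe (A : SL(2, ℂ)) (X : SL2LieAlgebra) :
    (adjointRep A X).1 = (A : Matrix (Fin 2) (Fin 2) ℂ) * X.1 *
      ((A⁻¹ : SL(2, ℂ)) : Matrix (Fin 2) (Fin 2) ℂ) := rfl

theorem adjointRep_neg (A : SL(2, ℂ)) : adjointRep (-A) = adjointRep A := by
  ext X : 1
  apply Subtype.ext
  have h : (-A)⁻¹ = -A⁻¹ := by
    rw [inv_eq_iff_mul_eq_one]
    ext i j
    simp [-Matrix.SpecialLinearGroup.coe_inv]
  rw [adjointRep_apply_coe, adjointRep_apply_coe, h]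
  simp

theorem sl2Seminorm_adjointRep_sub_le (A : SL(2, ℂ)) (X : SL2LieAlgebra) :
    sl2Seminorm (adjointRep A X - X) ≤
      2 * entrySum ((A : Matrix (Fin 2) (Fin 2) ℂ) - 1) *
        entrySum ((A⁻¹ : SL(2, ℂ)) : Matrix (Fin 2) (Fin 2) ℂ) * sl2Seminorm X := by
  set B : Matrix (Fin 2) (Fin 2) ℂ := (A : Matrix (Fin 2) (Fin 2) ℂ) with hB
  set C : Matrix (Fin 2) (Fin 2) ℂ := ((A⁻¹ : SL(2, ℂ)) : Matrix (Fin 2) (Fin 2) ℂ) with hC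
  have hBC : B * C = 1 := by
    rw [hB, hC, ← Matrix.SpecialLinearGroup.coe_mul, mul_inv_cancel,
      Matrix.SpecialLinearGroup.coe_one]
  have h : (adjointRep A X - X).1 = ((B - 1) * X.1 + -(X.1 * (B - 1))) * C := by
    change B * X.1 * C - X.1 = _
    have : X.1 * B * C = X.1 := by rw [mul_assoc, hBC, mul_one]
    simp only [sub_mul, mul_sub, add_mul, neg_mul, one_mul, mul_one, this]
    abel
  rw [sl2Seminorm_apply, sl2Seminorm_apply, h]
  have h1 := entrySum_mul_le ((B - 1) * X.1 + -(X.1 * (B - 1))) C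
  have h2 := entrySum_add_le ((B - 1) * X.1) (-(X.1 * (B - 1)))
  rw [entrySum_neg] at h2
  have h3 := entrySum_mul_le (B - 1) X.1
  have h4 := entrySum_mul_le X.1 (B - 1)
  have h5 := entrySum_nonneg C
  nlinarith [mul_le_mul_of_nonneg_right (h2.trans (add_le_add h3 h4)) h5]

/-- The adjoint representation is close to the identity near `1`. -/
theorem exists_isOpen_adjointRep_near_one {ε : ℝ} (hε : 0 < ε) :
    ∃ U : Set SL(2, ℂ), IsOpen U ∧ 1 ∈ U ∧ ∀ A ∈ U,
      (∀ X, sl2Seminorm (adjointRep A X - X) ≤ ε * sl2Seminorm X) ∧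
      ∀ X, sl2Seminorm (adjointRep A⁻¹ X - X) ≤ ε * sl2Seminorm X := by
  have hc : Continuous fun A : SL(2, ℂ) => (A : Matrix (Fin 2) (Fin 2) ℂ) := continuous_subtype_val
  have hf : Continuous fun A : SL(2, ℂ) => 2 * entrySum ((A : Matrix (Fin 2) (Fin 2) ℂ) - 1) *
      entrySum ((A⁻¹ : SL(2, ℂ)) : Matrix (Fin 2) (Fin 2) ℂ) :=
    (continuous_const.mul (continuous_entrySum.comp (hc.sub continuous_const))).mul
      (continuous_entrySum.comp (hc.comp continuous_inv))
  have h0 : 2 * entrySum (((1 : SL(2, ℂ)) : Matrix (Fin 2) (Fin 2) ℂ) - 1) *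
      entrySum (((1 : SL(2, ℂ))⁻¹ : SL(2, ℂ)) : Matrix (Fin 2) (Fin 2) ℂ) = 0 := by
    rw [Matrix.SpecialLinearGroup.coe_one, sub_self]
    simp [entrySum]
  refine ⟨{A | 2 * entrySum ((A : Matrix (Fin 2) (Fin 2) ℂ) - 1) *
      entrySum ((A⁻¹ : SL(2, ℂ)) : Matrix (Fin 2) (Fin 2) ℂ) < ε} ∩
      {A | 2 * entrySum (((A⁻¹ : SL(2, ℂ)) : Matrix (Fin 2) (Fin 2) ℂ) - 1) *
      entrySum ((A⁻¹⁻¹ : SL(2, ℂ)) : Matrix (Fin 2) (Fin 2) ℂ) < ε},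
    (isOpen_lt hf continuous_const).inter (isOpen_lt (hf.comp continuous_inv) continuous_const),
    ⟨?_, ?_⟩, ?_⟩
  · rw [Set.mem_ofPred_eq, h0]
    exact hε
  · rw [Set.mem_ofPred_eq, inv_one, h0]
    exact hε
  · rintro A ⟨h1, h2⟩
    exact ⟨fun X => (sl2Seminorm_adjointRep_sub_le A X).trans
        (mul_le_mul_of_nonneg_right (le_of_lt h1) (apply_nonneg _ _)),
      fun X => (sl2Seminorm_adjointRep_sub_le A⁻¹ X).trans
        (mul_le_mul_of_nonneg_right (le_of_lt h2) (apply_nonneg _ _))⟩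

theorem adjointRep_eq_self_iff (A : SL(2, ℂ)) (X : SL2LieAlgebra) :
    adjointRep A X = X ↔ (A : Matrix (Fin 2) (Fin 2) ℂ) * X.1 = X.1 * A := by
  have hBC : ((A⁻¹ : SL(2, ℂ)) : Matrix (Fin 2) (Fin 2) ℂ) * A = 1 := by
    rw [← Matrix.SpecialLinearGroup.coe_mul, inv_mul_cancel, Matrix.SpecialLinearGroup.coe_one]
  have hCB : (A : Matrix (Fin 2) (Fin 2) ℂ) *
      ((A⁻¹ : SL(2, ℂ)) : Matrix (Fin 2) (Fin 2) ℂ) = 1 := by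
    rw [← Matrix.SpecialLinearGroup.coe_mul, mul_inv_cancel, Matrix.SpecialLinearGroup.coe_one]
  rw [← Subtype.coe_inj, adjointRep_apply_coe]
  constructor
  · intro h
    conv_rhs => rw [← h]
    rw [mul_assoc _ _ (A : Matrix (Fin 2) (Fin 2) ℂ), hBC, mul_one]
  · intro h
    rw [h, mul_assoc, hCB, mul_one]

theorem eq_one_or_eq_neg_one_of_scalar (A : SL(2, ℂ)) (hb : A.1 0 1 = 0) (hc : A.1 1 0 = 0)
    (hd : A.1 1 1 = A.1 0 0) : A = 1 ∨ A = -1 := by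
  have hdet : A.1 0 0 * A.1 1 1 - A.1 0 1 * A.1 1 0 = 1 := by
    have := A.2
    rwa [Matrix.det_fin_two] at this
  rw [hb, hc, hd] at hdet
  have hsq : (A.1 0 0 - 1) * (A.1 0 0 + 1) = 0 := by linear_combination hdet
  rcases mul_eq_zero.1 hsq with h | h
  · left
    have ha : A.1 0 0 = 1 := sub_eq_zero.1 h
    ext i j
    fin_cases i <;> fin_cases j <;> simp [hb, hc, hd, ha]
  · right
    have ha : A.1 0 0 = -1 := eq_neg_of_add_eq_zero_left h
    ext i j
    fin_cases i <;> fin_cases j <;> simp [hb, hc, hd, ha]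

/-- The invariants are the centralizer of `ρ μ` in `sl₂(ℂ)`, which is a line because `ρ μ` is not
central. -/
theorem finrank_invariants_eq_one {Γ : Type*} [Group Γ] (ρ : Γ →* SL(2, ℂ)) (μ : Γ)
    (hρ : ∀ g, ρ g ∈ Subgroup.zpowers (ρ μ)) (h1 : ρ μ ≠ 1) (h2 : ρ μ ≠ -1) :
    Module.finrank ℂ
      (Representation.invariants (adjointRep.comp ρ : Representation ℂ Γ SL2LieAlgebra)) = 1 := by
  set τ : Representation ℂ Γ SL2LieAlgebra := adjointRep.comp ρ
  have hmem : ∀ X, X ∈ τ.invariants ↔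
      (ρ μ : Matrix (Fin 2) (Fin 2) ℂ) * X.1 = X.1 * ρ μ := by
    intro X
    rw [← adjointRep_eq_self_iff]
    refine ⟨fun h => h μ, fun h g => ?_⟩
    have hs : ρ μ ∈ (MulAction.stabilizer (SL2LieAlgebra →ₗ[ℂ] SL2LieAlgebra)ˣ X).comap
        (adjointRep.asGroupHom) := by
      rw [Subgroup.mem_comap, MulAction.mem_stabilizer_iff]
      exact h
    have := (Subgroup.zpowers_le.2 hs) (hρ g)
    rw [Subgroup.mem_comap, MulAction.mem_stabilizer_iff] at this
    exact this
  set A := ρ μ with hA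
  set a := A.1 0 0
  set b := A.1 0 1
  set c := A.1 1 0
  set d := A.1 1 1
  have hAeq : (A : Matrix (Fin 2) (Fin 2) ℂ) = !![a, b; c, d] := Matrix.eta_fin_two A.1
  -- The traceless part of `ρ μ` spans the centralizer.
  let X₀ : SL2LieAlgebra := ⟨!![(a - d) / 2, b; c, -((a - d) / 2)], by
    change Matrix.trace (!![(a - d) / 2, b; c, -((a - d) / 2)] : Matrix (Fin 2) (Fin 2) ℂ) = 0
    simp [Matrix.trace_fin_two]⟩
  have hX₀ : X₀ ∈ τ.invariants := by
    rw [hmem, hAeq]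
    ext i j
    fin_cases i <;> fin_cases j <;> simp [X₀] <;> ring
  refine finrank_eq_one (⟨X₀, hX₀⟩ : τ.invariants) ?_ ?_
  · intro h
    have h : X₀.1 = 0 := congrArg (fun X => X.1.1) h
    have e0 : (a - d) / 2 = 0 := congrFun (congrFun h 0) 0
    have eb : b = 0 := congrFun (congrFun h 0) 1
    have ec : c = 0 := congrFun (congrFun h 1) 0
    have ed : d = a := by linear_combination (-2) * e0
    exact (eq_one_or_eq_neg_one_of_scalar A eb ec ed).elim h1 h2
  · rintro ⟨X, hX⟩
    have hX' := (hmem X).1 hX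
    have htr : X.1 0 0 + X.1 1 1 = 0 := by
      have : Matrix.trace X.1 = 0 := X.2
      rwa [Matrix.trace_fin_two] at this
    set x := X.1 0 0
    set y := X.1 0 1
    set z := X.1 1 0
    have hXeq : X.1 = !![x, y; z, -x] := by
      rw [← eq_neg_of_add_eq_zero_right htr]
      exact Matrix.eta_fin_two X.1
    rw [hAeq, hXeq] at hX'
    have e1 := congrFun (congrFun hX' 0) 0
    have e2 := congrFun (congrFun hX' 0) 1
    have e3 := congrFun (congrFun hX' 1) 0
    simp at e1 e2 e3
    have key : ∃ r : ℂ, r * ((a - d) / 2) = x ∧ r * b = y ∧ r * c = z := by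
      by_cases he : (a - d) / 2 = 0
      · by_cases hb : b = 0
        · by_cases hc : c = 0
          · exfalso
            exact (eq_one_or_eq_neg_one_of_scalar A hb hc (by linear_combination (-2) * he)).elim
              h1 h2
          · refine ⟨z / c, ?_, ?_, by field_simp⟩
            · field_simp
              linear_combination (-1 : ℂ) * e3
            · field_simp
              linear_combination e1
        · refine ⟨y / b, ?_, by field_simp, ?_⟩
          · field_simp
            linear_combination e2
          · field_simp
            linear_combination (-1 : ℂ) * e1
      · have he' : a - d ≠ 0 := fun h => he (by rw [h, zero_div])
        refine ⟨x / ((a - d) / 2), by field_simp, ?_, ?_⟩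
        · field_simp
          linear_combination (-1 : ℂ) * e2
        · field_simp
          linear_combination e3
    obtain ⟨r, r1, r2, r3⟩ := key
    refine ⟨r, Subtype.ext (Subtype.ext ?_)⟩
    change r • X₀.1 = X.1
    rw [hXeq, ← r1, ← r2, ← r3]
    ext i j
    fin_cases i <;> fin_cases j <;> simp [X₀]

end Adjoint

/-! ### Local systems on the sphere -/

/-- A local system on `Y` with structure group `G`, given by charts: functions `h i : Y → G` that
are regarded on the open set `U i` only, and differ on overlaps by locally constant right
factors. -/
structure FlatAtlas (Y G ι : Type*) [TopologicalSpace Y] [Group G] where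
  /-- The domains of the charts. -/
  U : ι → Set Y
  /-- The charts. -/
  h : ι → Y → G
  isOpen_U : ∀ i, IsOpen (U i)
  exists_mem_U : ∀ y, ∃ i, y ∈ U i
  locallyConst : ∀ i j, ∀ x ∈ U i ∩ U j, ∀ᶠ y in 𝓝 x, (h i y)⁻¹ * h j y = (h i x)⁻¹ * h j x

namespace FlatAtlas

variable {Y G ι : Type*} [TopologicalSpace Y] [Group G] (𝒜 : FlatAtlas Y G ι)

/-- A flat section of a local system over a set. -/
def IsFlatOn (A : Set Y) (g : Y → G) : Prop :=
  ∀ i, ∀ x ∈ 𝒜.U i ∩ A, ∀ᶠ y in 𝓝 x, (𝒜.h i y)⁻¹ * g y = (𝒜.h i x)⁻¹ * g x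

/-- The covering space of a local system, as a bundle with discrete fiber `G`. -/
noncomputable def bundleCore [TopologicalSpace G] [DiscreteTopology G] :
    FiberBundleCore ι Y G where
  baseSet := 𝒜.U
  isOpen_baseSet := 𝒜.isOpen_U
  indexAt y := (𝒜.exists_mem_U y).choose
  mem_baseSet_at y := (𝒜.exists_mem_U y).choose_spec
  coordChange i j y v := (𝒜.h j y)⁻¹ * 𝒜.h i y * v
  coordChange_self i y _ v := by simp
  continuousOn_coordChange i j := by
    rintro ⟨x, v⟩ ⟨⟨hi, hj⟩, -⟩
    refine ContinuousAt.continuousWithinAt ?_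
    have h1 : (fun p : Y × G => (𝒜.h j p.1)⁻¹ * 𝒜.h i p.1 * p.2) =ᶠ[𝓝 (x, v)]
        fun p => (𝒜.h j x)⁻¹ * 𝒜.h i x * p.2 := by
      have := (𝒜.locallyConst j i x ⟨hj, hi⟩)
      rw [nhds_prod_eq]
      filter_upwards [this.prod_inl (𝓝 v)] with p hp
      rw [hp]
    refine ContinuousAt.congr ?_ h1.symm
    exact (continuous_of_discreteTopology
      (f := fun w : G => (𝒜.h j x)⁻¹ * 𝒜.h i x * w)).continuousAt.comp continuous_snd.continuousAt
  coordChange_comp i j k y _ v := by group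

/-- A local system has a flat section over a simply connected open subset. -/
theorem exists_isFlatOn_of_simplyConnected {A : Type*} [TopologicalSpace A]
    [SimplyConnectedSpace A] [LocallyPathConnectedSpace A] {f : A → Y}
    (hf : Topology.IsOpenEmbedding f) : ∃ g, 𝒜.IsFlatOn (Set.range f) g := by
  let _ : TopologicalSpace G := ⊥
  have : DiscreteTopology G := ⟨rfl⟩
  let Z := 𝒜.bundleCore
  have hcov : IsCoveringMap (Bundle.TotalSpace.proj : Z.TotalSpace → Y) :=
    FiberBundle.isCoveringMap (F := G) (E := Z.Fiber)
  obtain ⟨a₀⟩ : Nonempty A := inferInstance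
  let e₀ : Z.TotalSpace := ⟨f a₀, (1 : G)⟩
  obtain ⟨F, ⟨-, hF⟩, -⟩ := hcov.existsUnique_continuousMap_lifts ⟨f, hf.continuous⟩ a₀ e₀ rfl
  have hF' : ∀ a, (F a).proj = f a := fun a => congrFun hF a
  let s : A → G := fun a => (F a).2
  -- The section in the chart `i` is `(h i)⁻¹ * g`.
  have hcoord : ∀ i a, (Z.localTriv i (F a)).2 =
      (𝒜.h i (f a))⁻¹ * (𝒜.h (Z.indexAt (F a).1) (f a) * s a) := by
    intro i a
    rw [FiberBundleCore.localTriv_apply]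
    change (𝒜.h i (F a).1)⁻¹ * 𝒜.h _ (F a).1 * s a = _
    rw [hF', mul_assoc]
  let g : A → G := fun a => 𝒜.h (Z.indexAt (F a).1) (f a) * s a
  have hg : ∀ i a, f a ∈ 𝒜.U i →
      ∀ᶠ b in 𝓝 a, (𝒜.h i (f b))⁻¹ * g b = (𝒜.h i (f a))⁻¹ * g a := by
    intro i a ha
    have hsrc : F a ∈ (Z.localTriv i).source := by
      rw [FiberBundleCore.mem_localTriv_source]
      change (F a).1 ∈ 𝒜.U i
      rwa [hF']
    have hc : ContinuousAt (fun b => (Z.localTriv i (F b)).2) a :=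
      continuous_snd.continuousAt.comp
        (((Z.localTriv i).continuousAt hsrc).comp F.continuous.continuousAt)
    have := hc.eventually (IsOpen.mem_nhds (isOpen_discrete {(Z.localTriv i (F a)).2}) rfl)
    filter_upwards [this] with b hb
    have hb : (Z.localTriv i (F b)).2 = (Z.localTriv i (F a)).2 := hb
    rwa [hcoord, hcoord] at hb
  refine ⟨Function.extend f g 1, ?_⟩
  rintro i x ⟨hx, a, rfl⟩
  rw [← hf.map_nhds_eq, Filter.eventually_map]
  filter_upwards [hg i a hx] with b hb
  rw [hf.injective.extend_apply, hf.injective.extend_apply, hb]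

/-- Flat sections over two open sets with connected intersection can be glued. -/
theorem IsFlatOn.exists_glue {A B : Set Y} (hA : IsOpen A) (hB : IsOpen B)
    (hAB : A ∪ B = Set.univ) (hconn : IsPreconnected (A ∩ B)) {gA gB : Y → G}
    (hgA : 𝒜.IsFlatOn A gA) (hgB : 𝒜.IsFlatOn B gB) : ∃ g, 𝒜.IsFlatOn Set.univ g := by
  classical
  obtain ⟨c, hc⟩ : ∃ c, ∀ y ∈ A ∩ B, gB y = gA y * c := by
    rcases (A ∩ B).eq_empty_or_nonempty with he | ⟨x, hx⟩
    · exact ⟨1, by simp [he]⟩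
    have : PreconnectedSpace ↥(A ∩ B) := isPreconnected_iff_preconnectedSpace.1 hconn
    have hloc : IsLocallyConstant fun y : ↥(A ∩ B) => (gA y)⁻¹ * gB y := by
      rw [IsLocallyConstant.iff_eventually_eq]
      intro ⟨y, hy⟩
      obtain ⟨i, hi⟩ := 𝒜.exists_mem_U y
      have h1 := hgA i y ⟨hi, hy.1⟩
      have h2 := hgB i y ⟨hi, hy.2⟩
      have ht : Filter.Tendsto (Subtype.val : ↥(A ∩ B) → Y) (𝓝 ⟨y, hy⟩) (𝓝 y) :=
        continuous_subtype_val.continuousAt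
      filter_upwards [ht.eventually h1, ht.eventually h2] with z hz1 hz2
      have e1 : gA z = 𝒜.h i z * ((𝒜.h i y)⁻¹ * gA y) := by rw [← hz1]; group
      have e2 : gB z = 𝒜.h i z * ((𝒜.h i y)⁻¹ * gB y) := by rw [← hz2]; group
      rw [e1, e2]
      group
    refine ⟨(gA x)⁻¹ * gB x, fun y hy => ?_⟩
    rw [← hloc.apply_eq_of_preconnectedSpace ⟨y, hy⟩ ⟨x, hx⟩]
    group
  refine ⟨fun y => if y ∈ A then gA y * c else gB y, ?_⟩
  rintro i x ⟨hx, -⟩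
  by_cases hxA : x ∈ A
  · filter_upwards [hgA i x ⟨hx, hxA⟩, hA.mem_nhds hxA] with y hy hyA
    rw [if_pos hxA, if_pos hyA, ← mul_assoc, hy, mul_assoc]
  · have hxB : x ∈ B := (Set.eq_univ_iff_forall.1 hAB x).resolve_left hxA
    have key : ∀ y ∈ B, (if y ∈ A then gA y * c else gB y) = gB y := by
      intro y hy
      split_ifs with h
      · exact (hc y ⟨h, hy⟩).symm
      · rfl
    filter_upwards [hgB i x ⟨hx, hxB⟩, hB.mem_nhds hxB] with y hy hyB
    rw [key x hxB, key y hyB, hy]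

/-- A local system on the three-sphere has a flat section: it has one over the complement of each of
two points, and the intersection of these complements is connected. -/
theorem exists_isFlatOn_univ (𝒜 : FlatAtlas S3 G ι) : ∃ g, 𝒜.IsFlatOn Set.univ g := by
  let v : EuclideanSpace ℝ (Fin 4) := EuclideanSpace.single 0 1
  have hv : ‖v‖ = 1 := by simp [v]
  have hvv : v ≠ -v := by
    intro h
    have h0 := congrArg (fun w : EuclideanSpace ℝ (Fin 4) => w 0) h
    norm_num [v] at h0
  have hv' : ‖-v‖ = 1 := by rw [norm_neg, hv]
  have hs : ∀ (w : EuclideanSpace ℝ (Fin 4)) (hw : ‖w‖ = 1),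
      ∃ g, 𝒜.IsFlatOn {(⟨w, by simp [hw]⟩ : S3)}ᶜ g := by
    intro w hw
    have h := 𝒜.exists_isFlatOn_of_simplyConnected (isOpenEmbedding_stereographic_symm hw)
    rwa [range_stereographic_symm] at h
  obtain ⟨gA, hgA⟩ := hs v hv
  obtain ⟨gB, hgB⟩ := hs (-v) hv'
  refine IsFlatOn.exists_glue 𝒜 isClosed_singleton.isOpen_compl isClosed_singleton.isOpen_compl
    ?_ ?_ hgA hgB
  · rw [Set.eq_univ_iff_forall]
    intro x
    by_contra! hx
    simp only [Set.mem_union, Set.mem_compl_iff, Set.mem_singleton_iff, not_or, not_not] at hx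
    exact hvv (congrArg Subtype.val (hx.1.symm.trans hx.2))
  · -- The stereographic projection from `v` maps the sphere without `v` and `-v` to the complement
    -- of the origin.
    have : Fact (Module.finrank ℝ (EuclideanSpace ℝ (Fin 4)) = 3 + 1) := ⟨by simp⟩
    have hrank : 1 < Module.rank ℝ (ℝ ∙ v)ᗮ := by
      refine Module.lt_rank_of_lt_finrank ?_
      rw [Submodule.finrank_orthogonal_span_singleton (n := 3) (by
        intro h
        rw [h, norm_zero] at hv
        exact zero_ne_one hv)]
      norm_num
    have himg := (isConnected_compl_singleton_of_one_lt_rank hrank 0).isPreconnected.image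
      (stereographic hv).symm
      (isOpenEmbedding_stereographic_symm hv).continuous.continuousOn
    have h0 : (stereographic hv).symm 0 = ⟨-v, by simp [hv]⟩ := by
      have := stereographic_apply_neg (⟨v, by simp [hv]⟩ : S3)
      rw [← this]
      exact (stereographic hv).left_inv (by
        rw [stereographic_source]
        intro h
        exact hvv (congrArg Subtype.val (show (⟨-v, _⟩ : S3) = ⟨v, _⟩ from h)).symm)
    rw [Set.image_compl_eq_range_sdiff_image (isOpenEmbedding_stereographic_symm hv).injective,
      Set.image_singleton, h0, range_stereographic_symm] at himg
    exact himg

end FlatAtlas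

/-! ### Parallel transport with values in the fundamental group -/

section Transport

variable {X : Type*} [TopologicalSpace X] [PathConnectedSpace X] (x₀ : X)

/-- A path becomes an element of the fundamental group when both of its endpoints are connected with
the basepoint by chosen paths. -/
noncomputable def transport {x y : X} (γ : Path x y) : FundamentalGroup X x₀ :=
  FundamentalGroup.fromPath
    (((Path.Homotopic.Quotient.mk (PathConnectedSpace.somePath x₀ x)).trans (.mk γ)).trans
      (Path.Homotopic.Quotient.mk (PathConnectedSpace.somePath x₀ y)).symm)

theorem transport_trans {x y z : X} (γ : Path x y) (δ : Path y z) :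
    transport x₀ (γ.trans δ) = transport x₀ δ * transport x₀ γ := by
  rw [FundamentalGroup.mul_def]
  simp only [transport, Path.Homotopic.Quotient.mk_trans]
  simp only [Path.Homotopic.Quotient.trans_assoc]
  rw [← Path.Homotopic.Quotient.trans_assoc (Path.Homotopic.Quotient.symm _)
    (Path.Homotopic.Quotient.mk (PathConnectedSpace.somePath x₀ y)),
    Path.Homotopic.Quotient.symm_trans, Path.Homotopic.Quotient.refl_trans]

theorem transport_homotopic {x y : X} {γ γ' : Path x y} (h : γ.Homotopic γ') :
    transport x₀ γ = transport x₀ γ' := by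
  rw [transport, transport, Path.Homotopic.Quotient.eq.2 h]

theorem transport_congr {x y x' y' : X} {γ : Path x y} {γ' : Path x' y'}
    (h : ∀ t, γ t = γ' t) : transport x₀ γ = transport x₀ γ' := by
  obtain rfl : x = x' := by simpa using h 0
  obtain rfl : y = y' := by simpa using h 1
  obtain rfl : γ = γ' := Path.ext (funext h)
  rfl

theorem exists_transport_eq (x : X) (g : FundamentalGroup X x₀) :
    ∃ γ : Path x x, transport x₀ γ = g := by
  obtain ⟨γ, hγ⟩ := Path.Homotopic.Quotient.mk_surjective
    (((Path.Homotopic.Quotient.mk (PathConnectedSpace.somePath x₀ x)).symm.trans g.toPath).trans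
      (Path.Homotopic.Quotient.mk (PathConnectedSpace.somePath x₀ x)))
  refine ⟨γ, ?_⟩
  rw [transport, hγ]
  simp only [Path.Homotopic.Quotient.trans_assoc, Path.Homotopic.Quotient.trans_symm,
    Path.Homotopic.Quotient.trans_refl]
  rw [← Path.Homotopic.Quotient.trans_assoc, Path.Homotopic.Quotient.trans_symm,
    Path.Homotopic.Quotient.refl_trans]

/-- Along a map from a simply connected space, the transport depends only on the endpoints. -/
theorem exists_transport_map_eq {A : Type*} [TopologicalSpace A] [SimplyConnectedSpace A]
    (e : C(A, X)) : ∃ h : A → FundamentalGroup X x₀, ∀ {a b : A} (δ : Path a b),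
      transport x₀ (δ.map e.continuous) = h b * (h a)⁻¹ := by
  obtain ⟨a₀⟩ : Nonempty A := inferInstance
  refine ⟨fun a => transport x₀ ((PathConnectedSpace.somePath a₀ a).map e.continuous),
    fun {a b} δ => ?_⟩
  rw [eq_mul_inv_iff_mul_eq, ← transport_trans, ← Path.map_trans]
  exact transport_homotopic x₀ ((SimplyConnectedSpace.paths_homotopic _ _).map e)

theorem exists_transport_eq_of_simplyConnected (V : Set X) [SimplyConnectedSpace V] :
    ∃ h : X → FundamentalGroup X x₀, ∀ {a b : X} (δ : Path a b), (∀ t, δ t ∈ V) →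
      transport x₀ δ = h b * (h a)⁻¹ := by
  classical
  obtain ⟨h, hh⟩ := exists_transport_map_eq x₀ (⟨Subtype.val, continuous_subtype_val⟩ : C(V, X))
  refine ⟨fun a => if ha : a ∈ V then h ⟨a, ha⟩ else 1, fun {a b} δ hδ => ?_⟩
  have ha : a ∈ V := by simpa using hδ 0
  have hb : b ∈ V := by simpa using hδ 1
  beta_reduce
  rw [dif_pos ha, dif_pos hb]
  let δ' : Path (⟨a, ha⟩ : V) ⟨b, hb⟩ :=
    ⟨⟨fun t => ⟨δ t, hδ t⟩, by fun_prop⟩, by simp, by simp⟩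
  rw [← hh δ']
  exact transport_congr x₀ fun t => rfl

/-- If the transport is equivariant along short paths, then it is so along all paths. -/
theorem transport_smul_eq_of_local {S : Type*} [MulAction (FundamentalGroup X x₀) S] (g : X → S)
    {x y : X} (γ : Path x y)
    (hloc : ∀ t, ∃ U ∈ 𝓝 (γ t), ∀ {a b : X} (δ : Path a b), (∀ s, δ s ∈ U) →
      transport x₀ δ • g a = g b) : transport x₀ γ • g x = g y := by
  have hI : ContractibleSpace unitInterval := (convex_Icc (0 : ℝ) 1).contractibleSpace ⟨0, by simp⟩
  have hL : LocallyPathConnectedSpace unitInterval :=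
    (convex_Icc (0 : ℝ) 1).locallyPathConnectedSpace
  obtain ⟨k, hk⟩ := exists_transport_map_eq x₀ γ.toContinuousMap
  have hc : IsLocallyConstant fun t => (k t)⁻¹ • g (γ t) := by
    rw [IsLocallyConstant.iff_eventually_eq]
    intro t
    obtain ⟨U, hU, hUδ⟩ := hloc t
    obtain ⟨V, ⟨hV, hVc⟩, hVU⟩ := (path_connected_basis t).mem_iff.1
      (γ.continuous.continuousAt.preimage_mem_nhds hU)
    filter_upwards [hV] with s hs
    obtain ⟨δ, hδ⟩ := hVc.joinedIn t (mem_of_mem_nhds hV) s hs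
    have h1 := hUδ (δ.map γ.continuous) fun r => hVU (hδ r)
    have h2 := hk δ
    change transport x₀ (δ.map γ.continuous) = _ at h2
    rw [h2, mul_smul] at h1
    rw [← h1, inv_smul_smul]
  have h01 := hc.apply_eq_of_preconnectedSpace 0 1
  let ι : Path (0 : unitInterval) 1 := ⟨⟨id, continuous_id⟩, rfl, rfl⟩
  have hγ : transport x₀ γ = k 1 * (k 0)⁻¹ := by
    rw [← hk ι]
    exact transport_congr x₀ fun t => rfl
  beta_reduce at h01
  rw [γ.source, γ.target] at h01
  rw [hγ, mul_smul, h01, smul_inv_smul]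

/-- Transport along a map with a symmetry `τ`: the path from a point to its translate is a loop, and
all of these loops are conjugate. -/
theorem exists_transport_map_eq_of_periodic {A : Type*} [TopologicalSpace A]
    [SimplyConnectedSpace A] (e : C(A, X)) {h : A → FundamentalGroup X x₀}
    (hh : ∀ {a b : A} (δ : Path a b), transport x₀ (δ.map e.continuous) = h b * (h a)⁻¹)
    (τ : C(A, A)) (hτ : ∀ a, e (τ a) = e a) : ∃ m, ∀ a, h (τ a) = h a * m := by
  obtain ⟨a₀⟩ : Nonempty A := inferInstance
  refine ⟨(h a₀)⁻¹ * h (τ a₀), fun a => ?_⟩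
  let δ := PathConnectedSpace.somePath a₀ a
  have h1 := hh δ
  have h2 := hh (δ.map τ.continuous)
  rw [transport_congr x₀ (γ' := δ.map e.continuous) fun t => hτ _, h1] at h2
  rw [← mul_assoc, h2]
  group

end Transport

/-! ### Finite generation of the fundamental group -/

section FiniteGeneration

variable {X : Type*} [MetricSpace X] [PathConnectedSpace X] [StronglyLocallyContractibleSpace X]

/-- The loops in a compact subset of a locally contractible space lie in a finitely generated
subgroup: cover the subset by finitely many small sets; only finitely many transitions occur between
the trivializations of the transport over these sets. -/
theorem exists_fg_forall_transport_mem (x₀ : X) {M : Set X} (hM : IsCompact M) (x₁ : X) :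
    ∃ H : Subgroup (FundamentalGroup X x₀), H.FG ∧
      ∀ γ : Path x₁ x₁, (∀ t, γ t ∈ M) → transport x₀ γ ∈ H := by
  classical
  have hV : ∀ y : X, ∃ V ∈ 𝓝 y, ∃ h : X → FundamentalGroup X x₀, ∀ {a b : X} (δ : Path a b),
      (∀ t, δ t ∈ V) → transport x₀ δ = h b * (h a)⁻¹ := by
    intro y
    obtain ⟨V, ⟨hV, hVc⟩, -⟩ := (contractible_basis y).mem_iff.1 Filter.univ_mem
    exact ⟨V, hV, exists_transport_eq_of_simplyConnected x₀ V⟩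
  choose V hVy h hh using hV
  obtain ⟨r, hr, hball⟩ := lebesgue_number_lemma_of_metric hM (c := fun y => interior (V y))
    (fun y => isOpen_interior) fun y _ => Set.mem_iUnion.2 ⟨y, mem_interior_iff_mem_nhds.2 (hVy y)⟩
  have hB : ∀ x : X, ∃ B ∈ 𝓝 x, IsPathConnected B ∧ B ⊆ Metric.ball x (r / 4) := by
    intro x
    obtain ⟨B, ⟨hB, hBc⟩, hBr⟩ := (path_connected_basis x).mem_iff.1
      (Metric.ball_mem_nhds x (by positivity : 0 < r / 4))
    exact ⟨B, hB, hBc, hBr⟩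
  choose B hBx hBc hBr using hB
  have hball' : ∀ x : M, ∃ y, Metric.ball (x : X) r ⊆ V y := fun x => by
    obtain ⟨y, hy⟩ := hball x x.2
    exact ⟨y, hy.trans interior_subset⟩
  choose y hy using hball'
  obtain ⟨t, ht⟩ := hM.elim_nhds_subcover' (fun x _ => interior (B x))
    fun x _ => interior_mem_nhds.2 (hBx x)
  have hBV : ∀ x : M, B x ⊆ V (y x) := fun x =>
    (hBr x).trans ((Metric.ball_subset_ball (by linarith)).trans (hy x))
  -- On the intersection of two of the sets, the transition is constant.
  have htrans : ∀ x x' : M, ∀ z ∈ B x ∩ B x', ∀ w ∈ B x ∩ B x',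
      (h (y x) z)⁻¹ * h (y x') z = (h (y x) w)⁻¹ * h (y x') w := by
    intro x x' z hz w hw
    obtain ⟨δ, hδ⟩ := (hBc x).joinedIn z hz.1 w hw.1
    obtain ⟨δ', hδ'⟩ := (hBc x').joinedIn z hz.2 w hw.2
    have h1 := hh (y x) δ fun s => hBV x (hδ s)
    have h2 := hh (y x') δ' fun s => hBV x' (hδ' s)
    have h3 := hh (y x) δ' fun s => by
      refine hy x ?_
      have d1 := Metric.mem_ball.1 (hBr x hz.1)
      have d2 := Metric.mem_ball.1 (hBr x' hz.2)
      have d3 := Metric.mem_ball.1 (hBr x' (hδ' s))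
      rw [Metric.mem_ball]
      have := dist_triangle4 (δ' s) x' z x
      rw [dist_comm (x' : X) z] at this
      linarith
    have h4 : h (y x) w * (h (y x) z)⁻¹ = h (y x') w * (h (y x') z)⁻¹ := h3.symm.trans h2
    have h5 : h (y x') w = h (y x) w * (h (y x) z)⁻¹ * h (y x') z := by
      rw [h4]
      group
    rw [h5]
    group
  let c : M × M → FundamentalGroup X x₀ := fun p =>
    if hp : (B p.1 ∩ B p.2 : Set X).Nonempty then
      (h (y p.1) hp.some)⁻¹ * h (y p.2) hp.some else 1
  let H : Subgroup (FundamentalGroup X x₀) := Subgroup.closure ((t ×ˢ t).image c : Set _)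
  have hc : ∀ x ∈ t, ∀ x' ∈ t, ∀ z ∈ B x ∩ B x', (h (y x) z)⁻¹ * h (y x') z ∈ H := by
    intro x hx x' hx' z hz
    have hp : (B x ∩ B x' : Set X).Nonempty := ⟨z, hz⟩
    have : (h (y x) z)⁻¹ * h (y x') z = c (x, x') := by
      rw [htrans x x' z hz _ hp.some_mem]
      simp only [c]
      rw [dif_pos hp]
    rw [this]
    exact Subgroup.subset_closure (Finset.mem_coe.2
      (Finset.mem_image_of_mem c (Finset.mk_mem_product hx hx')))
  let g : X → FundamentalGroup X x₀ ⧸ H := fun z =>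
    if hz : ∃ x ∈ t, z ∈ B x then (h (y hz.choose) z : FundamentalGroup X x₀ ⧸ H)
    else ((1 : FundamentalGroup X x₀) : FundamentalGroup X x₀ ⧸ H)
  have hg : ∀ x ∈ t, ∀ z ∈ B x, g z = (h (y x) z : FundamentalGroup X x₀ ⧸ H) := by
    intro x hx z hz
    have he : ∃ x ∈ t, z ∈ B x := ⟨x, hx, hz⟩
    refine (dif_pos he).trans ?_
    exact QuotientGroup.eq.2 (hc _ he.choose_spec.1 x hx z ⟨he.choose_spec.2, hz⟩)
  obtain ⟨u, hu⟩ := QuotientGroup.mk_surjective (g x₁)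
  refine ⟨H.map (MulAut.conj u).toMonoidHom, ⟨((t ×ˢ t).image c).image (MulAut.conj u), by
    rw [Finset.coe_image]
    exact (MonoidHom.map_closure (MulAut.conj u).toMonoidHom _).symm⟩, fun γ hγ => ?_⟩
  have hsmul : transport x₀ γ • g x₁ = g x₁ := by
    refine transport_smul_eq_of_local x₀ g γ fun s => ?_
    obtain ⟨x, hx, hxs⟩ := Set.mem_iUnion₂.1 (ht (hγ s))
    refine ⟨B x, mem_interior_iff_mem_nhds.1 hxs, fun {a b} δ hδ => ?_⟩
    have ha : a ∈ B x := by simpa using hδ 0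
    have hb : b ∈ B x := by simpa using hδ 1
    rw [hg x hx a ha, hg x hx b hb, hh (y x) δ fun s => hBV x (hδ s)]
    change ((h (y x) b * (h (y x) a)⁻¹ * h (y x) a : FundamentalGroup X x₀) :
      FundamentalGroup X x₀ ⧸ H) = _
    rw [inv_mul_cancel_right]
  rw [← hu] at hsmul
  have hmem : u⁻¹ * (transport x₀ γ * u) ∈ H := QuotientGroup.eq.1 hsmul.symm
  refine ⟨_, hmem, ?_⟩
  change u * (u⁻¹ * (transport x₀ γ * u)) * u⁻¹ = _
  group

end FiniteGeneration

/-! ### The complement of a knot -/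

section Complement

theorem stronglyLocallyContractibleSpace_of_normedSpace (E : Type*) [NormedAddCommGroup E]
    [NormedSpace ℝ E] : StronglyLocallyContractibleSpace E :=
  .of_bases (fun _ => Metric.nhds_basis_ball) fun x _ hr =>
    (convex_ball x _).contractibleSpace ⟨x, Metric.mem_ball_self hr⟩

theorem exists_contractible_nhds_of_isOpenEmbedding {E Y : Type*} [TopologicalSpace E]
    [TopologicalSpace Y] [StronglyLocallyContractibleSpace E] {f : E → Y}
    (hf : Topology.IsOpenEmbedding f) (a : E) {t : Set Y} (ht : t ∈ 𝓝 (f a)) :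
    ∃ r ∈ 𝓝 (f a), ContractibleSpace r ∧ r ⊆ t := by
  obtain ⟨s, ⟨hs, hsc⟩, hst⟩ := (contractible_basis a).mem_iff.1
    (hf.continuous.continuousAt.preimage_mem_nhds ht)
  refine ⟨f '' s, hf.image_mem_nhds.2 hs, ?_, Set.image_subset_iff.2 hst⟩
  exact (hf.toIsEmbedding.homeomorphImage s).contractibleSpace_iff.1 hsc

instance stronglyLocallyContractibleSpace_S3 : StronglyLocallyContractibleSpace S3 where
  contractible_basis x := by
    rw [Filter.hasBasis_self]
    intro t ht
    have hv : ‖-(x : EuclideanSpace ℝ (Fin 4))‖ = 1 := by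
      rw [norm_neg, norm_eq_of_mem_sphere]
    have hx : x ∈ Set.range (stereographic hv).symm := by
      rw [range_stereographic_symm]
      intro h
      have h0 : (x : EuclideanSpace ℝ (Fin 4)) = -x := congrArg Subtype.val h
      have h1 : (x : EuclideanSpace ℝ (Fin 4)) = 0 := by
        have h2 : (2 : ℝ) • (x : EuclideanSpace ℝ (Fin 4)) = 0 := by
          rw [two_smul]
          nth_rw 2 [h0]
          exact add_neg_cancel _
        exact (smul_eq_zero.1 h2).resolve_left two_ne_zero
      rw [h1, neg_zero, norm_zero] at hv
      exact zero_ne_one hv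
    obtain ⟨a, ha⟩ := hx
    have := stronglyLocallyContractibleSpace_of_normedSpace
      (ℝ ∙ (-(x : EuclideanSpace ℝ (Fin 4))))ᗮ
    have h := exists_contractible_nhds_of_isOpenEmbedding
      (isOpenEmbedding_stereographic_symm hv) a (t := t) (by rwa [ha])
    rw [ha] at h
    exact h

instance preconnectedSpace_S3 : PreconnectedSpace S3 := by
  refine isPreconnected_iff_preconnectedSpace.1 (isPreconnected_sphere ?_ _ _)
  refine Module.lt_rank_of_lt_finrank ?_
  simp

namespace TubularNeighbourhood

variable {K : Set S3} (N : TubularNeighbourhood K)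

theorem toFun_mem_iff (z : Circle) (w : ℂ) : N.toFun (z, w) ∈ K ↔ w = 0 := by
  refine (Set.ext_iff.1 N.range_core _).symm.trans ?_
  constructor
  · rintro ⟨z', h⟩
    exact (congrArg Prod.snd (N.isOpenEmbedding.injective h)).symm
  · rintro rfl
    exact ⟨z, rfl⟩

include N in
theorem isOpen_compl : IsOpen Kᶜ := by
  rw [← N.range_core]
  have hc : Continuous fun z : Circle => N.toFun (z, 0) :=
    N.isOpenEmbedding.continuous.comp (by fun_prop)
  exact (isCompact_range hc).isClosed.isOpen_compl

/-- Logarithmic polar coordinates around a knot: the universal covering of the punctured tubular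
neighbourhood. -/
noncomputable def polar : C(ℝ × ℂ, ↥Kᶜ) where
  toFun p := ⟨N.toFun (Circle.exp p.1, Complex.exp p.2), fun h =>
    Complex.exp_ne_zero _ ((N.toFun_mem_iff _ _).1 h)⟩
  continuous_toFun := Continuous.subtype_mk (N.isOpenEmbedding.continuous.comp (by fun_prop)) _

theorem coe_polar (p : ℝ × ℂ) :
    (N.polar p : S3) = N.toFun (Circle.exp p.1, Complex.exp p.2) := rfl

theorem polar_eq_iff_of (p q : ℝ × ℂ) (h₁ : Circle.exp p.1 = Circle.exp q.1)
    (h₂ : Complex.exp p.2 = Complex.exp q.2) : N.polar p = N.polar q :=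
  Subtype.ext (by rw [coe_polar, coe_polar, h₁, h₂])

theorem exists_polar_eq (z : Circle) {w : ℂ} (hw : w ≠ 0) :
    ∃ p, (N.polar p : S3) = N.toFun (z, w) :=
  ⟨(Complex.arg z, Complex.log w), by rw [coe_polar, Circle.exp_arg, Complex.exp_log hw]⟩

include N in
theorem pathConnectedSpace_compl : PathConnectedSpace ↥Kᶜ := by
  have hopen : IsOpen Kᶜ := N.isOpen_compl
  have hrange : IsPreconnected (Set.range fun p => (N.polar p : S3)) :=
    isPreconnected_range (continuous_subtype_val.comp N.polar.continuous)
  have hrangeK : (Set.range fun p => (N.polar p : S3)) ⊆ Kᶜ := by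
    rintro _ ⟨p, rfl⟩
    exact (N.polar p).2
  have hV : ∀ x ∈ Set.range N.toFun, x ∈ Kᶜ → x ∈ Set.range fun p => (N.polar p : S3) := by
    rintro _ ⟨⟨z, w⟩, rfl⟩ hx
    exact N.exists_polar_eq z fun h => hx ((N.toFun_mem_iff z w).2 h)
  -- If the punctured neighbourhood lies in the part `u` of a separation of the complement, then
  -- adding the knot to `u` gives a separation of the sphere.
  have key : ∀ u v : Set S3, IsOpen u → IsOpen v → Kᶜ ⊆ u ∪ v → Kᶜ ∩ (u ∩ v) = ∅ →
      (Set.range fun p => (N.polar p : S3)) ⊆ u → Kᶜ ⊆ u := by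
    intro u v hu hv huv hd hr
    have hdisj : ((Kᶜ ∩ u) ∪ Set.range N.toFun) ∩ (Kᶜ ∩ v) = ∅ := by
      rw [Set.eq_empty_iff_forall_notMem]
      rintro x ⟨h1 | h1, h2⟩
      · exact Set.eq_empty_iff_forall_notMem.1 hd x ⟨h1.1, h1.2, h2.2⟩
      · exact Set.eq_empty_iff_forall_notMem.1 hd x ⟨h2.1, hr (hV x h1 h2.1), h2.2⟩
    have hcover : Set.univ ⊆ ((Kᶜ ∩ u) ∪ Set.range N.toFun) ∪ (Kᶜ ∩ v) := by
      intro x _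
      by_cases hx : x ∈ K
      · rw [← N.range_core] at hx
        obtain ⟨z, rfl⟩ := hx
        exact Or.inl (Or.inr ⟨_, rfl⟩)
      · rcases huv hx with h | h
        · exact Or.inl (Or.inl ⟨hx, h⟩)
        · exact Or.inr ⟨hx, h⟩
    have := isPreconnected_iff_subset_of_disjoint.1 (isPreconnected_univ (α := S3)) _ _
      ((hopen.inter hu).union N.isOpenEmbedding.isOpen_range) (hopen.inter hv) hcover
      (by rw [hdisj, Set.inter_empty])
    rcases this with h | h
    · intro x hx
      rcases h (Set.mem_univ x) with h' | h'
      · exact h'.2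
      · exact hr (hV x h' hx)
    · exact absurd ((N.toFun_mem_iff 1 0).2 rfl) (h (Set.mem_univ (N.toFun (1, 0)))).1
  have hpre : IsPreconnected Kᶜ := by
    rw [isPreconnected_iff_subset_of_disjoint]
    intro u v hu hv huv hd
    have h0 := isPreconnected_iff_subset_of_disjoint.1 hrange u v hu hv (hrangeK.trans huv)
      (by
        rw [← Set.subset_empty_iff, ← hd]
        exact Set.inter_subset_inter_left _ hrangeK)
    rcases h0 with h | h
    · exact Or.inl (key u v hu hv huv hd h)
    · exact Or.inr (key v u hv hu (by rwa [Set.union_comm]) (by rwa [Set.inter_comm v u]) h)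
  have : PreconnectedSpace ↥Kᶜ := isPreconnected_iff_preconnectedSpace.1 hpre
  have : ConnectedSpace ↥Kᶜ := { toNonempty := ⟨N.polar 0⟩ }
  have := hopen.locallyPathConnectedSpace
  exact PathConnectedSpace.of_locallyPathConnectedSpace

/-- Coordinates in a tubular neighbourhood. -/
noncomputable def coord : S3 → Circle × ℂ :=
  (N.isOpenEmbedding.toOpenPartialHomeomorph N.toFun).symm

theorem coord_toFun (p : Circle × ℂ) : N.coord (N.toFun p) = p :=
  (N.isOpenEmbedding.toOpenPartialHomeomorph N.toFun).left_inv (by simp)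

theorem continuousAt_coord (p : Circle × ℂ) : ContinuousAt N.coord (N.toFun p) :=
  (N.isOpenEmbedding.toOpenPartialHomeomorph N.toFun).symm.continuousAt (by simp)

end TubularNeighbourhood

end Complement

/-! ### The knot group is normally generated by the meridian -/

section NormalGeneration

/-- `f` is a local trivialization near `x` of the transport, pushed forward by `φ`. -/
def IsFlatAt {X G : Type*} [TopologicalSpace X] [PathConnectedSpace X] [Group G] {x₀ : X}
    (φ : FundamentalGroup X x₀ →* G) (f : X → G) (x : X) : Prop :=
  ∃ O ∈ 𝓝 x, ∀ {a b : X} (δ : Path a b), (∀ t, δ t ∈ O) → φ (transport x₀ δ) = f b * (f a)⁻¹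

theorem IsFlatAt.eventually_eq {X G : Type*} [TopologicalSpace X] [PathConnectedSpace X]
    [LocallyPathConnectedSpace X] [Group G] {x₀ : X} {φ : FundamentalGroup X x₀ →* G}
    {f f' : X → G} {x : X} (hf : IsFlatAt φ f x) (hf' : IsFlatAt φ f' x) :
    ∀ᶠ y in 𝓝 x, (f y)⁻¹ * f' y = (f x)⁻¹ * f' x := by
  obtain ⟨O, hO, h⟩ := hf
  obtain ⟨O', hO', h'⟩ := hf'
  obtain ⟨V, ⟨hV, hVc⟩, hVO⟩ := (path_connected_basis x).mem_iff.1 (Filter.inter_mem hO hO')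
  filter_upwards [hV] with y hy
  obtain ⟨δ, hδ⟩ := hVc.joinedIn x (mem_of_mem_nhds hV) y hy
  have h1 := h δ fun t => (hVO (hδ t)).1
  rw [h' δ fun t => (hVO (hδ t)).2] at h1
  have h2 : f' y = f y * (f x)⁻¹ * f' x := by
    rw [← h1]
    group
  rw [h2]
  group

namespace TubularNeighbourhood

variable {K : Set S3} (N : TubularNeighbourhood K)

/-- The straight path from `0` to `2πi` in the universal covering of the punctured tubular
neighbourhood; its image is a meridian. -/
noncomputable def meridianSegment : Path ((0, 0) : ℝ × ℂ) (0, 2 * Real.pi * Complex.I) where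
  toFun t := (0, (t : ℝ) * (2 * Real.pi * Complex.I))
  continuous_toFun := by fun_prop
  source' := by simp
  target' := by simp

/-- The meridian as an element of the fundamental group of the complement of the knot. -/
noncomputable def complMeridian [PathConnectedSpace ↥Kᶜ] (x₀ : ↥Kᶜ) :
    FundamentalGroup ↥Kᶜ x₀ :=
  transport x₀ (meridianSegment.map N.polar.continuous)

/-- The translation of the angle by a multiple of `2π` and of the logarithm by a multiple
of `2πi`. -/
noncomputable def polarShift (p : ℝ × ℂ) : C(ℝ × ℂ, ℝ × ℂ) := ⟨fun q => q + p, by fun_prop⟩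

theorem polar_add (p : ℝ × ℂ) (h₁ : Circle.exp p.1 = 1) (h₂ : Complex.exp p.2 = 1) (q : ℝ × ℂ) :
    N.polar (polarShift p q) = N.polar q :=
  N.polar_eq_iff_of _ _ (by simp [polarShift, Circle.exp_add, h₁])
    (by simp [polarShift, Complex.exp_add, h₂])

section Meridian

variable [PathConnectedSpace ↥Kᶜ] (x₀ : ↥Kᶜ)

/-- If `φ` kills the meridian, then the transport in the punctured tubular neighbourhood depends
only on the angle and on the image in the neighbourhood. -/
theorem exists_polar_trivialization {G : Type*} [Group G] (φ : FundamentalGroup ↥Kᶜ x₀ →* G)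
    (hφ : φ (N.complMeridian x₀) = 1) : ∃ η : ℝ × ℂ → G,
      (∀ {p q : ℝ × ℂ} (δ : Path p q),
        φ (transport x₀ (δ.map N.polar.continuous)) = η q * (η p)⁻¹) ∧
      (∀ θ l l', Complex.exp l = Complex.exp l' → η (θ, l) = η (θ, l')) ∧
      ∀ s, Circle.exp s = 1 → ∃ c, ∀ θ l, η (θ + s, l) = η (θ, l) * c := by
  obtain ⟨h, hh⟩ := exists_transport_map_eq x₀ N.polar
  refine ⟨φ ∘ h, fun δ => by rw [hh δ, map_mul, map_inv]; rfl, ?_, ?_⟩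
  · obtain ⟨m, hm⟩ := exists_transport_map_eq_of_periodic x₀ N.polar hh
      (polarShift (0, 2 * Real.pi * Complex.I)) (N.polar_add _ (by simp) Complex.exp_two_pi_mul_I)
    have hm1 : φ m = 1 := by
      have h1 : N.complMeridian x₀ = h (0, 0) * m * (h (0, 0))⁻¹ := by
        rw [complMeridian, hh, ← hm]
        simp [polarShift]
      rw [h1, map_mul, map_mul, map_inv, mul_inv_eq_one] at hφ
      simpa using hφ
    intro θ l l' hl
    have hper : Function.Periodic (fun l => φ (h (θ, l))) (2 * Real.pi * Complex.I) := by
      intro l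
      have := congrArg φ (hm (θ, l))
      rw [map_mul, hm1, mul_one] at this
      beta_reduce
      rw [← this]
      simp [polarShift]
    obtain ⟨n, rfl⟩ := Complex.exp_eq_exp_iff_exists_int.1 hl
    exact hper.int_mul n l'
  · intro s hs
    obtain ⟨m, hm⟩ := exists_transport_map_eq_of_periodic x₀ N.polar hh
      (polarShift (s, 0)) (N.polar_add _ hs Complex.exp_zero)
    refine ⟨φ m, fun θ l => ?_⟩
    have := congrArg φ (hm (θ, l))
    rw [map_mul] at this
    change φ (h (θ + s, l)) = φ (h (θ, l)) * _
    rw [← this]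
    simp [polarShift]

/-- The branch of the angle on the circle without the antipode of `exp (ia)`. -/
noncomputable def angleBranch (a : ℝ) (z : Circle) : ℝ :=
  a + Complex.arg (z / Circle.exp a : Circle)

theorem exp_angleBranch (a : ℝ) (z : Circle) : Circle.exp (angleBranch a z) = z := by
  rw [angleBranch, Circle.exp_add, Circle.exp_arg, mul_div_cancel]

/-- The arc on which the branch of the angle is continuous. -/
def angleArc (a : ℝ) : Set Circle := {z | ((z / Circle.exp a : Circle) : ℂ) ∈ Complex.slitPlane}

theorem isOpen_angleArc (a : ℝ) : IsOpen (angleArc a) :=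
  Complex.isOpen_slitPlane.preimage (by fun_prop)

theorem continuousAt_angleBranch {a : ℝ} {z : Circle} (hz : z ∈ angleArc a) :
    ContinuousAt (angleBranch a) z :=
  continuousAt_const.add ((Complex.continuousAt_arg hz).comp
    (f := fun z : Circle => ((z / Circle.exp a : Circle) : ℂ)) (by fun_prop))

theorem mem_angleArc_arg (z : Circle) : z ∈ angleArc (Complex.arg z) := by
  simp [angleArc, Circle.exp_arg]

/-- Two branches of the angle differ by a locally constant function. -/
theorem eventually_angleBranch_sub {a b : ℝ} {z : Circle} (ha : z ∈ angleArc a)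
    (hb : z ∈ angleArc b) : ∀ᶠ z' in 𝓝 z,
      angleBranch b z' - angleBranch a z' = angleBranch b z - angleBranch a z := by
  have hc : ContinuousAt (fun z => angleBranch b z - angleBranch a z) z :=
    (continuousAt_angleBranch hb).sub (continuousAt_angleBranch ha)
  have hint : ∀ z, ∃ n : ℤ, angleBranch b z - angleBranch a z = n * (2 * Real.pi) := by
    intro z
    have h : Circle.exp (angleBranch b z) = Circle.exp (angleBranch a z) := by
      rw [exp_angleBranch, exp_angleBranch]
    obtain ⟨n, hn⟩ := Circle.exp_eq_exp.1 h
    exact ⟨n, by rw [hn]; ring⟩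
  have hpi := Real.pi_pos
  filter_upwards [hc.eventually (Metric.ball_mem_nhds _ (by positivity : 0 < 2 * Real.pi))]
    with z' hz'
  obtain ⟨n, hn⟩ := hint z
  obtain ⟨n', hn'⟩ := hint z'
  rw [hn, hn', Real.dist_eq, ← sub_mul, abs_mul,
    abs_of_pos (by positivity : 0 < 2 * Real.pi), mul_lt_iff_lt_one_left (by positivity)] at hz'
  rw [hn, hn']
  have : |n' - n| < 1 := by exact_mod_cast hz'
  rw [Int.abs_lt_one_iff, sub_eq_zero] at this
  rw [this]

/-- A chart of the local system given by `φ` near an arc of the knot.  On the knot itself it uses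
the junk value `log 0 = 0`. -/
noncomputable def arcChart {G : Type*} (η : ℝ × ℂ → G) (a : ℝ) (x : S3) : G :=
  η (angleBranch a (N.coord x).1, Complex.log (N.coord x).2)

theorem arcChart_isFlatAt {G : Type*} [Group G] {φ : FundamentalGroup ↥Kᶜ x₀ →* G} {η : ℝ × ℂ → G}
    (hη : ∀ {p q : ℝ × ℂ} (δ : Path p q),
        φ (transport x₀ (δ.map N.polar.continuous)) = η q * (η p)⁻¹)
    (hexp : ∀ θ l l', Complex.exp l = Complex.exp l' → η (θ, l) = η (θ, l'))
    {a : ℝ} {z : Circle} (hz : z ∈ angleArc a) {w : ℂ} (x : ↥Kᶜ)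
    (hx : (x : S3) = N.toFun (z, w)) : IsFlatAt φ (fun y : ↥Kᶜ => N.arcChart η a y) x := by
  have hw : w ≠ 0 := fun h => x.2 (hx ▸ (N.toFun_mem_iff z w).2 h)
  -- A local section of `polar`, defined by branches of the angle and of the logarithm.
  let σ : S3 → ℝ × ℂ := fun y =>
    (angleBranch a (N.coord y).1, Complex.log w + Complex.log ((N.coord y).2 / w))
  let P : Set (Circle × ℂ) := {p | p.1 ∈ angleArc a ∧ p.2 / w ∈ Complex.slitPlane}
  have hP : IsOpen P := ((isOpen_angleArc a).preimage continuous_fst).inter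
    (Complex.isOpen_slitPlane.preimage (by fun_prop))
  have hσc : ∀ p ∈ P, ContinuousAt σ (N.toFun p) := by
    intro p hp
    have hcoord := N.continuousAt_coord p
    refine ContinuousAt.prodMk ?_ (continuousAt_const.add ?_)
    · refine ContinuousAt.comp (g := angleBranch a) (f := fun y => (N.coord y).1) ?_
        (continuous_fst.continuousAt.comp hcoord)
      rw [N.coord_toFun]
      exact continuousAt_angleBranch hp.1
    · refine ContinuousAt.comp (g := Complex.log) (f := fun y => (N.coord y).2 / w) ?_
        ((continuous_snd.continuousAt.comp hcoord).div_const w)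
      rw [N.coord_toFun]
      exact continuousAt_clog hp.2
  have hexpσ : ∀ p ∈ P, Complex.exp (σ (N.toFun p)).2 = p.2 := by
    intro p hp
    simp only [σ, N.coord_toFun]
    rw [Complex.exp_add, Complex.exp_log hw, Complex.exp_log (Complex.slitPlane_ne_zero hp.2)]
    field_simp
  have hσ : ∀ p ∈ P, (N.polar (σ (N.toFun p)) : S3) = N.toFun p := by
    intro p hp
    rw [coe_polar, hexpσ p hp]
    simp only [σ, N.coord_toFun, exp_angleBranch]
  have hησ : ∀ p ∈ P, N.arcChart η a (N.toFun p) = η (σ (N.toFun p)) := by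
    intro p hp
    have hp2 : p.2 ≠ 0 := fun h => Complex.slitPlane_ne_zero hp.2 (by rw [h, zero_div])
    simp only [arcChart]
    rw [hexp _ _ (σ (N.toFun p)).2 (by
      rw [hexpσ p hp, N.coord_toFun, Complex.exp_log hp2])]
  have hxP : (z, w) ∈ P := ⟨hz, by simp [div_self hw]⟩
  refine ⟨Subtype.val ⁻¹' (N.toFun '' P), continuous_subtype_val.continuousAt.preimage_mem_nhds
    (by
      rw [hx]
      exact N.isOpenEmbedding.image_mem_nhds.2 (hP.mem_nhds hxP)), fun {a' b'} δ hδ => ?_⟩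
  have hcδ : Continuous fun t => σ (δ t) := by
    rw [continuous_iff_continuousAt]
    intro t
    obtain ⟨p, hp, hpt⟩ := hδ t
    refine ContinuousAt.comp (g := σ) (f := fun t => (δ t : S3)) ?_
      (continuous_subtype_val.comp δ.continuous).continuousAt
    beta_reduce
    rw [← hpt]
    exact hσc p hp
  let δ' : Path (σ a') (σ b') := ⟨⟨fun t => σ (δ t), hcδ⟩, by simp, by simp⟩
  have h1 := hη δ'
  rw [transport_congr x₀ (γ' := δ) fun t => Subtype.ext (by
    obtain ⟨p, hp, hpt⟩ := hδ t
    change (N.polar (σ (δ t)) : S3) = δ t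
    rw [← hpt]
    exact hσ p hp)] at h1
  rw [h1]
  obtain ⟨p, hp, hpt⟩ := hδ 0
  obtain ⟨q, hq, hqt⟩ := hδ 1
  rw [δ.source] at hpt
  rw [δ.target] at hqt
  beta_reduce
  rw [← hpt, ← hqt, hησ p hp, hησ q hq]

variable {x₀} in
/-- A homomorphism from the group of the knot that kills the meridian is trivial: its local system
extends to the sphere, where it has a flat section. -/
theorem eq_one_of_map_complMeridian_eq_one {G : Type*} [Group G]
    (φ : FundamentalGroup ↥Kᶜ x₀ →* G) (hφ : φ (N.complMeridian x₀) = 1)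
    (g : FundamentalGroup ↥Kᶜ x₀) : φ g = 1 := by
  classical
  have hopen : IsOpen Kᶜ := N.isOpen_compl
  have : StronglyLocallyContractibleSpace ↥Kᶜ := hopen.stronglyLocallyContractibleSpace
  obtain ⟨η, hη, hexp, hshift⟩ := N.exists_polar_trivialization x₀ φ hφ
  have hV : ∀ y : ↥Kᶜ, ∃ V ∈ 𝓝 y, ∃ h : ↥Kᶜ → FundamentalGroup ↥Kᶜ x₀,
      ∀ {a b : ↥Kᶜ} (δ : Path a b), (∀ t, δ t ∈ V) → transport x₀ δ = h b * (h a)⁻¹ := by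
    intro y
    obtain ⟨V, ⟨hV, hVc⟩, -⟩ := (contractible_basis y).mem_iff.1 Filter.univ_mem
    exact ⟨V, hV, exists_transport_eq_of_simplyConnected x₀ V⟩
  choose V hVy k hk using hV
  let U : ↥Kᶜ ⊕ ℝ → Set S3
    | .inl y => Subtype.val '' interior (V y)
    | .inr a => N.toFun '' {p | p.1 ∈ angleArc a}
  let h : ↥Kᶜ ⊕ ℝ → S3 → G
    | .inl y => fun x => if hx : x ∈ Kᶜ then φ (k y ⟨x, hx⟩) else 1
    | .inr a => N.arcChart η a
  have hUK : ∀ y, U (.inl y) ⊆ Kᶜ := by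
    rintro y _ ⟨x, -, rfl⟩
    exact x.2
  have hflat : ∀ i, ∀ x : ↥Kᶜ, (x : S3) ∈ U i → IsFlatAt φ (fun y : ↥Kᶜ => h i y) x := by
    rintro (y | a) x hx
    · obtain ⟨x', hx', hxx'⟩ := hx
      obtain rfl : x' = x := Subtype.ext hxx'
      refine ⟨V y, mem_interior_iff_mem_nhds.1 hx', fun {a b} δ hδ => ?_⟩
      have he : ∀ c : ↥Kᶜ, h (.inl y) c = φ (k y c) := fun c => dif_pos c.2
      beta_reduce
      rw [he, he, hk y δ hδ, map_mul, map_inv]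
    · obtain ⟨⟨z, w⟩, hz, hxz⟩ := hx
      exact N.arcChart_isFlatAt x₀ hη hexp hz x hxz.symm
  let 𝒜 : FlatAtlas S3 G (↥Kᶜ ⊕ ℝ) :=
    { U := U
      h := h
      isOpen_U := by
        rintro (y | a)
        · exact hopen.isOpenMap_subtype_val _ isOpen_interior
        · exact N.isOpenEmbedding.isOpenMap _ ((isOpen_angleArc a).preimage continuous_fst)
      exists_mem_U := by
        intro y
        by_cases hy : y ∈ K
        · have hy' := hy
          rw [← N.range_core] at hy'
          obtain ⟨z, rfl⟩ := hy'
          exact ⟨.inr (Complex.arg z), (z, 0), mem_angleArc_arg z, rfl⟩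
        · exact ⟨.inl ⟨y, hy⟩, ⟨y, hy⟩, mem_interior_iff_mem_nhds.2 (hVy _), rfl⟩
      locallyConst := by
        rintro i j x ⟨hi, hj⟩
        by_cases hx : x ∈ K
        · obtain ⟨a, rfl⟩ : ∃ a, i = .inr a := by
            rcases i with y | a
            · exact absurd hx (hUK y hi)
            · exact ⟨a, rfl⟩
          obtain ⟨b, rfl⟩ : ∃ b, j = .inr b := by
            rcases j with y | b
            · exact absurd hx (hUK y hj)
            · exact ⟨b, rfl⟩
          obtain ⟨p, hp, rfl⟩ := hi
          obtain ⟨q, hq, hqp⟩ := hj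
          obtain rfl := N.isOpenEmbedding.injective hqp
          obtain ⟨c, hc⟩ := hshift (angleBranch b q.1 - angleBranch a q.1) (by
            rw [Circle.exp_sub, exp_angleBranch, exp_angleBranch, div_self'])
          have ht : Filter.Tendsto (fun y => (N.coord y).1) (𝓝 (N.toFun q)) (𝓝 q.1) := by
            have := continuous_fst.continuousAt.comp (N.continuousAt_coord q)
            rw [ContinuousAt] at this
            simpa [N.coord_toFun, Function.comp_def] using this
          have key : ∀ y, angleBranch b (N.coord y).1 - angleBranch a (N.coord y).1 =
              angleBranch b q.1 - angleBranch a q.1 →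
              (N.arcChart η a y)⁻¹ * N.arcChart η b y = c := by
            intro y hy
            simp only [arcChart]
            have : angleBranch b (N.coord y).1 = angleBranch a (N.coord y).1 +
              (angleBranch b q.1 - angleBranch a q.1) := by rw [← hy]; ring
            rw [this, hc]
            group
          filter_upwards [ht.eventually (eventually_angleBranch_sub hp hq)] with y hy
          change (N.arcChart η a y)⁻¹ * N.arcChart η b y =
            (N.arcChart η a (N.toFun q))⁻¹ * N.arcChart η b (N.toFun q)
          rw [key y hy, key _ (by rw [N.coord_toFun])]
        · have h1 := (hflat i ⟨x, hx⟩ hi).eventually_eq (hflat j ⟨x, hx⟩ hj)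
          have h2 := hopen.isOpenEmbedding_subtypeVal.map_nhds_eq ⟨x, hx⟩
          change Filter.map Subtype.val _ = 𝓝 x at h2
          rw [← h2]
          exact Filter.eventually_map.2 h1 }
  obtain ⟨s, hs⟩ := 𝒜.exists_isFlatOn_univ
  let _ : MulAction (FundamentalGroup ↥Kᶜ x₀) G := MulAction.compHom G φ
  obtain ⟨γ, rfl⟩ := exists_transport_eq x₀ x₀ g
  have hsmul := transport_smul_eq_of_local x₀ (fun y : ↥Kᶜ => s y) γ fun t => by
    have h1 := hs (.inl (γ t)) (γ t)
      ⟨⟨γ t, mem_interior_iff_mem_nhds.2 (hVy _), rfl⟩, Set.mem_univ _⟩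
    have h2 := continuous_subtype_val.continuousAt.eventually h1
    refine ⟨_, Filter.inter_mem (hVy (γ t)) h2, fun {a b} δ hδ => ?_⟩
    have he : ∀ c : ↥Kᶜ, 𝒜.h (.inl (γ t)) c = φ (k (γ t) c) := fun c => dif_pos c.2
    have ha : (φ (k (γ t) a))⁻¹ * s a = (φ (k (γ t) (γ t)))⁻¹ * s (γ t) := by
      rw [← he, ← he]
      simpa using (hδ 0).2
    have hb : (φ (k (γ t) b))⁻¹ * s b = (φ (k (γ t) (γ t)))⁻¹ * s (γ t) := by
      rw [← he, ← he]
      simpa using (hδ 1).2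
    have hk' := hk (γ t) δ fun r => (hδ r).1
    change φ (transport x₀ δ) * s a = s b
    rw [hk', map_mul, map_inv, mul_assoc, ha, ← hb]
    group
  have hsmul : φ (transport x₀ γ) * s x₀ = s x₀ := hsmul
  simpa using hsmul

theorem normalClosure_complMeridian :
    Subgroup.normalClosure {N.complMeridian x₀} = ⊤ := by
  rw [eq_top_iff]
  intro g _
  have := N.eq_one_of_map_complMeridian_eq_one
    (QuotientGroup.mk' (Subgroup.normalClosure {N.complMeridian x₀}))
    ((QuotientGroup.eq_one_iff _).2 (Subgroup.subset_normalClosure rfl)) g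
  exact (QuotientGroup.eq_one_iff _).1 this

end Meridian

end TubularNeighbourhood

end NormalGeneration

/-! ### Independence of the meridian of the tubular neighbourhood -/

section MeridianComparison

theorem exists_int_of_cexp_eq {A : Type*} [TopologicalSpace A] [ConnectedSpace A] {F G : A → ℂ}
    (hF : Continuous F) (hG : Continuous G) (h : ∀ a, Complex.exp (F a) = Complex.exp (G a)) :
    ∃ n : ℤ, ∀ a, F a = G a + n * (2 * Real.pi * Complex.I) := by
  have hex : ∀ a, ∃ n : ℤ, F a = G a + n * (2 * Real.pi * Complex.I) := fun a =>
    Complex.exp_eq_exp_iff_exists_int.1 (h a)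
  choose n hn using hex
  have hcont : Continuous n := by
    refine Int.isClosedEmbedding_coe_real.isEmbedding.continuous_iff.2 ?_
    have he : (fun a => ((n a : ℤ) : ℝ)) =
        fun a => ((F a - G a) / (2 * Real.pi * Complex.I)).re := by
      funext a
      rw [hn a, add_sub_cancel_left, mul_div_assoc, div_self Complex.two_pi_I_ne_zero, mul_one,
        Complex.intCast_re]
    change Continuous fun a => ((n a : ℤ) : ℝ)
    rw [he]
    fun_prop
  obtain ⟨a₀⟩ : Nonempty A := inferInstance
  exact ⟨n a₀, fun a => by rw [hn a, PreconnectedSpace.constant inferInstance hcont (x := a)]⟩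

namespace TubularNeighbourhood

variable {K : Set S3}

/-- In logarithmic coordinates, the map of the plane to the disk of radius `e ^ r` that is the
identity on the disk and the radial projection outside of it. -/
noncomputable def radialClamp (r : ℝ) : C(ℝ × ℂ, ℝ × ℂ) :=
  ⟨fun p => (p.1, p.2 + ((r - max r p.2.re : ℝ) : ℂ)), by fun_prop⟩

theorem radialClamp_re_le (r : ℝ) (p : ℝ × ℂ) : (radialClamp r p).2.re ≤ r := by
  change (p.2 + ((r - max r p.2.re : ℝ) : ℂ)).re ≤ r
  rw [Complex.add_re, Complex.ofReal_re]
  linarith [le_max_right r p.2.re]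

theorem radialClamp_of_re_le {r : ℝ} {p : ℝ × ℂ} (h : p.2.re ≤ r) : radialClamp r p = p := by
  change (p.1, p.2 + ((r - max r p.2.re : ℝ) : ℂ)) = p
  rw [max_eq_left h, sub_self, Complex.ofReal_zero, add_zero]

/-- The translation that corresponds to `n` turns around the meridian. -/
noncomputable def meridianShift (n : ℤ) : ℝ × ℂ := (0, n * (2 * Real.pi * Complex.I))

theorem radialClamp_add_meridianShift (r : ℝ) (p : ℝ × ℂ) :
    radialClamp r (p + meridianShift 1) = radialClamp r p + meridianShift 1 := by
  refine Prod.ext rfl ?_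
  have h : (p.2 + (meridianShift 1).2).re = p.2.re := by simp [meridianShift]
  change p.2 + (meridianShift 1).2 + ((r - max r (p.2 + (meridianShift 1).2).re : ℝ) : ℂ) =
    p.2 + ((r - max r p.2.re : ℝ) : ℂ) + (meridianShift 1).2
  rw [h]
  ring

theorem polar_add_meridianShift (N : TubularNeighbourhood K) (n : ℤ) (p : ℝ × ℂ) :
    N.polar (p + meridianShift n) = N.polar p :=
  N.polar_add (meridianShift n) (by simp [meridianShift])
    (Complex.exp_int_mul_two_pi_mul_I n) p

/-- A small part of the tubular neighbourhood `N'` lies in a given neighbourhood `O` of the knot. -/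
theorem exists_forall_toFun_mem (N' : TubularNeighbourhood K) {O : Set S3} (hO : IsOpen O)
    (hKO : K ⊆ O) : ∃ r : ℝ, ∀ z w, ‖w‖ ≤ Real.exp r → N'.toFun (z, w) ∈ O := by
  obtain ⟨u, v, -, hv, hu, hv0, huv⟩ := generalized_tube_lemma (isCompact_univ (X := Circle))
    (isCompact_singleton (x := (0 : ℂ))) (hO.preimage N'.isOpenEmbedding.continuous) (by
      rintro ⟨z, w⟩ ⟨-, hw⟩
      exact hKO ((N'.toFun_mem_iff z w).2 hw))
  obtain ⟨ε, hε, hball⟩ := Metric.isOpen_iff.1 hv 0 (hv0 rfl)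
  refine ⟨Real.log (ε / 2), fun z w hw => huv (Set.mk_mem_prod (hu (Set.mem_univ z)) (hball ?_))⟩
  rw [Real.exp_log (by positivity)] at hw
  rw [mem_ball_zero_iff]
  linarith

/-- The inclusion of a small part of one tubular neighbourhood in another, lifted to logarithmic
polar coordinates.  It maps a meridian to a curve that winds `a` times around the knot and not at
all along it, since it bounds a disk in the neighbourhood. -/
theorem exists_polar_lift (N N' : TubularNeighbourhood K) {r : ℝ}
    (hr : ∀ z w, ‖w‖ ≤ Real.exp r → N'.toFun (z, w) ∈ Set.range N.toFun) :
    ∃ (a : ℤ) (T : C(ℝ × ℂ, ℝ × ℂ)), (∀ p, N.polar (T p) = N'.polar (radialClamp r p)) ∧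
      ∀ p (n : ℤ), T (p + meridianShift n) = T p + meridianShift (n * a) := by
  -- The radial projection to the disk, whose lift is `radialClamp r`.
  let clamp : ℂ → ℂ := fun w => w * ((Real.exp r / max (Real.exp r) ‖w‖ : ℝ) : ℂ)
  have hpos : ∀ w : ℂ, 0 < max (Real.exp r) ‖w‖ := fun w =>
    lt_max_of_lt_left (Real.exp_pos r)
  have hclampc : Continuous clamp := by
    refine continuous_id.mul (Complex.continuous_ofReal.comp ?_)
    exact continuous_const.div (by fun_prop) fun w => (hpos w).ne'
  have hclamp : ∀ w, ‖clamp w‖ ≤ Real.exp r := by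
    intro w
    have h1 : 0 ≤ Real.exp r / max (Real.exp r) ‖w‖ := div_nonneg (Real.exp_pos r).le (hpos w).le
    change ‖w * ((Real.exp r / max (Real.exp r) ‖w‖ : ℝ) : ℂ)‖ ≤ _
    rw [norm_mul, Complex.norm_real, Real.norm_of_nonneg h1, mul_div_assoc', div_le_iff₀ (hpos w),
      mul_comm]
    exact mul_le_mul_of_nonneg_left (le_max_right _ _) (Real.exp_pos r).le
  have hclampexp : ∀ p : ℝ × ℂ, clamp (Complex.exp p.2) = Complex.exp (radialClamp r p).2 := by
    intro p
    change Complex.exp p.2 * _ = Complex.exp (p.2 + _)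
    rw [Complex.exp_add, ← Complex.ofReal_exp, Real.exp_sub, Complex.norm_exp,
      Real.exp_monotone.map_max]
  let Φ : ℝ × ℂ → Circle × ℂ := fun p => N.coord (N'.toFun (Circle.exp p.1, clamp p.2))
  have hΦ : ∀ p, N.toFun (Φ p) = N'.toFun (Circle.exp p.1, clamp p.2) := by
    intro p
    obtain ⟨q, hq⟩ := hr (Circle.exp p.1) _ (hclamp p.2)
    simp only [Φ]
    rw [← hq, N.coord_toFun]
  have hΦc : Continuous Φ := N.isOpenEmbedding.isEmbedding.continuous_iff.2 (by
    have he : N.toFun ∘ Φ = fun p : ℝ × ℂ => N'.toFun (Circle.exp p.1, clamp p.2) := funext hΦ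
    rw [he]
    exact N'.isOpenEmbedding.continuous.comp (by fun_prop))
  have hE : Continuous fun p : ℝ × ℂ => ((p.1, Complex.exp p.2) : ℝ × ℂ) := by fun_prop
  have hΦ0 : ∀ p : ℝ × ℂ, (Φ (p.1, Complex.exp p.2)).2 ≠ 0 := by
    intro p h0
    have h1 : N.toFun (Φ (p.1, Complex.exp p.2)) ∈ K := (N.toFun_mem_iff _ _).2 h0
    rw [hΦ, N'.toFun_mem_iff, hclampexp] at h1
    exact Complex.exp_ne_zero _ h1
  obtain ⟨Θ, ⟨-, hΘ⟩, -⟩ := Circle.isCoveringMap_exp.existsUnique_continuousMap_lifts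
    (⟨fun p => (Φ p).1, by fun_prop⟩ : C(ℝ × ℂ, Circle)) 0 (Complex.arg (Φ 0).1)
    (Circle.exp_arg _)
  obtain ⟨L, ⟨-, hL⟩, -⟩ := Complex.isCoveringMapOn_exp.existsUnique_continuousMap_lifts
    (⟨fun p => (Φ (p.1, Complex.exp p.2)).2, by fun_prop⟩ : C(ℝ × ℂ, ℂ)) (a₀ := 0)
    (e₀ := Complex.log (Φ ((0 : ℝ × ℂ).1, Complex.exp (0 : ℝ × ℂ).2)).2)
    (Complex.exp_log (hΦ0 0)) hΦ0
  have hL' : ∀ p, Complex.exp (L p) = (Φ (p.1, Complex.exp p.2)).2 := fun p => congrFun hL p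
  have hΘ' : ∀ p, Circle.exp (Θ p) = (Φ p).1 := fun p => congrFun hΘ p
  have hper : ∀ p : ℝ × ℂ, Complex.exp (p + meridianShift 1).2 = Complex.exp p.2 := by
    intro p
    change Complex.exp (p.2 + ((1 : ℤ) : ℂ) * (2 * Real.pi * Complex.I)) = _
    rw [Complex.exp_add, Complex.exp_int_mul_two_pi_mul_I, mul_one]
  have hfst : ∀ p : ℝ × ℂ, (p + meridianShift 1).1 = p.1 := fun p => add_zero p.1
  obtain ⟨a, ha⟩ := exists_int_of_cexp_eq (F := fun p => L (p + meridianShift 1)) (G := L)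
    (by fun_prop) L.continuous fun p => by
      rw [hL', hL', hper, hfst]
  let T : C(ℝ × ℂ, ℝ × ℂ) := ⟨fun p => (Θ (p.1, Complex.exp p.2), L p), by fun_prop⟩
  have hT1 : ∀ p, T (p + meridianShift 1) = T p + meridianShift a := by
    intro p
    refine Prod.ext ?_ (ha p)
    change Θ ((p + meridianShift 1).1, Complex.exp (p + meridianShift 1).2) =
      Θ (p.1, Complex.exp p.2) + 0
    rw [hper, hfst, add_zero]
  have hadd : ∀ m n : ℤ, meridianShift (m + n) = meridianShift m + meridianShift n := by
    intro m n
    refine Prod.ext (add_zero 0).symm ?_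
    change ((m + n : ℤ) : ℂ) * (2 * Real.pi * Complex.I) =
      (m : ℂ) * (2 * Real.pi * Complex.I) + (n : ℂ) * (2 * Real.pi * Complex.I)
    push_cast
    ring
  have h0 : meridianShift 0 = 0 := by simp [meridianShift]
  refine ⟨a, T, fun p => Subtype.ext ?_, fun p n => ?_⟩
  · change N.toFun (Circle.exp (Θ (p.1, Complex.exp p.2)), Complex.exp (L p)) =
      N'.toFun (Circle.exp p.1, Complex.exp (radialClamp r p).2)
    rw [hΘ', hL', ← hclampexp, ← hΦ (p.1, Complex.exp p.2)]
  · induction n using Int.induction_on with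
    | zero => rw [zero_mul, h0, add_zero, add_zero]
    | succ n ih => rw [hadd, ← add_assoc, hT1, ih, add_assoc, ← hadd, add_mul, one_mul]
    | pred n ih =>
      have h1 := hT1 (p + meridianShift (-n - 1))
      rw [add_assoc, ← hadd, sub_add_cancel, ih] at h1
      have h2 : meridianShift (-n * a) = meridianShift ((-n - 1) * a) + meridianShift a := by
        rw [← hadd]
        congr 1
        ring
      rw [h2, ← add_assoc] at h1
      exact (add_right_cancel h1).symm

/-- The winding number `a` in `exists_polar_lift` is `1` or `-1`: it is multiplied by the winding
number of a lift in the opposite direction when the two lifts are composed, and the composition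
turns around the knot once. -/
theorem exists_isUnit_polar_lift (N N' : TubularNeighbourhood K) :
    ∃ (r : ℝ) (a : ℤ) (T : C(ℝ × ℂ, ℝ × ℂ)), (a = 1 ∨ a = -1) ∧
      (∀ p, N.polar (T p) = N'.polar (radialClamp r p)) ∧
      ∀ p, T (p + meridianShift 1) = T p + meridianShift a := by
  have hKr : ∀ N : TubularNeighbourhood K, K ⊆ Set.range N.toFun := by
    intro N
    refine N.range_core.symm.subset.trans ?_
    rintro _ ⟨z, rfl⟩
    exact ⟨_, rfl⟩
  obtain ⟨r', hr'⟩ := N.exists_forall_toFun_mem N'.isOpenEmbedding.isOpen_range (hKr N')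
  obtain ⟨b, T', hT', hT's⟩ := N'.exists_polar_lift N hr'
  -- Where `N'` is thin enough, the projection in the construction of `T'` has no effect.
  let O : Set S3 := N.toFun '' {p | ‖p.2‖ < Real.exp r'}
  have hO : IsOpen O := N.isOpenEmbedding.isOpenMap _
    (isOpen_lt (by fun_prop) continuous_const)
  have hKO : K ⊆ O := by
    refine N.range_core.symm.subset.trans ?_
    rintro _ ⟨z, rfl⟩
    exact ⟨(z, 0), by simpa using Real.exp_pos r', rfl⟩
  obtain ⟨r, hr⟩ := N'.exists_forall_toFun_mem hO hKO
  obtain ⟨a, T, hT, hTs⟩ := N.exists_polar_lift N' fun z w hw =>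
    Set.image_subset_range _ _ (hr z w hw)
  have hTr : ∀ p, (T p).2.re ≤ r' := by
    intro p
    have h1 : (N.polar (T p) : S3) ∈ O := by
      rw [hT, coe_polar]
      refine hr _ _ ?_
      rw [Complex.norm_exp]
      exact Real.exp_le_exp.2 (radialClamp_re_le r p)
    obtain ⟨q, hq, hqT⟩ := h1
    rw [coe_polar] at hqT
    have h2 := N.isOpenEmbedding.injective hqT
    rw [h2] at hq
    have hq : ‖Complex.exp (T p).2‖ < Real.exp r' := hq
    rw [Complex.norm_exp] at hq
    exact (Real.exp_lt_exp.1 hq).le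
  have hcomp : ∀ p, Complex.exp (T' (T p)).2 = Complex.exp (radialClamp r p).2 := by
    intro p
    have h1 := hT' (T p)
    rw [radialClamp_of_re_le (hTr p), hT] at h1
    exact congrArg Prod.snd (N'.isOpenEmbedding.injective (congrArg Subtype.val h1))
  obtain ⟨n, hn⟩ := exists_int_of_cexp_eq (F := fun p => (T' (T p)).2)
    (G := fun p => (radialClamp r p).2) (by fun_prop) (by fun_prop) hcomp
  have h0 := hn 0
  have h1 := hn (0 + meridianShift 1)
  rw [hTs, hT's, radialClamp_add_meridianShift, Prod.snd_add, Prod.snd_add, h0] at h1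
  have hab : ((1 * a * b : ℤ) : ℂ) * (2 * Real.pi * Complex.I) =
      ((1 : ℤ) : ℂ) * (2 * Real.pi * Complex.I) := by
    change _ + ((1 * a * b : ℤ) : ℂ) * (2 * Real.pi * Complex.I) =
      _ + ((1 : ℤ) : ℂ) * (2 * Real.pi * Complex.I) + _ at h1
    linear_combination h1
  have hab := Int.cast_injective (mul_right_cancel₀ Complex.two_pi_I_ne_zero hab)
  rw [one_mul] at hab
  exact ⟨r, a, T, Int.eq_one_or_neg_one_of_mul_eq_one hab, hT, fun p => by rw [hTs, one_mul]⟩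

/-- The trivializations of the transport on the universal covering of the punctured tubular
neighbourhood, with the monodromy `m` of the meridian. -/
theorem exists_polar_transport (N : TubularNeighbourhood K) [PathConnectedSpace ↥Kᶜ] (x₀ : ↥Kᶜ) :
    ∃ (h : ℝ × ℂ → FundamentalGroup ↥Kᶜ x₀) (m : FundamentalGroup ↥Kᶜ x₀),
      (∀ {p q : ℝ × ℂ} (δ : Path p q),
        transport x₀ (δ.map N.polar.continuous) = h q * (h p)⁻¹) ∧
      (∀ p, h (p + meridianShift 1) = h p * m) ∧
      (∀ p, h (p + meridianShift (-1)) = h p * m⁻¹) ∧ IsConj m (N.complMeridian x₀) := by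
  obtain ⟨h, hh⟩ := exists_transport_map_eq x₀ N.polar
  obtain ⟨m, hm⟩ := exists_transport_map_eq_of_periodic x₀ N.polar hh
    (polarShift (meridianShift 1)) (N.polar_add_meridianShift 1)
  have hm : ∀ p, h (p + meridianShift 1) = h p * m := hm
  refine ⟨h, m, hh, hm, fun p => ?_, ?_⟩
  · have h1 := hm (p + meridianShift (-1))
    have h2 : p + meridianShift (-1) + meridianShift 1 = p := by
      rw [add_assoc]
      simp [meridianShift]
    rw [h2] at h1
    rw [h1, mul_inv_cancel_right]
  · rw [isConj_iff]
    refine ⟨h (0, 0), ?_⟩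
    have h1 : ((0, 2 * Real.pi * Complex.I) : ℝ × ℂ) = (0, 0) + meridianShift 1 := by
      simp [meridianShift]
    rw [complMeridian, hh, h1, hm]

/-- Up to conjugation and inversion, the meridian depends on the knot only. -/
theorem isConj_complMeridian (N N' : TubularNeighbourhood K) [PathConnectedSpace ↥Kᶜ]
    (x₀ : ↥Kᶜ) : IsConj (N.complMeridian x₀) (N'.complMeridian x₀) ∨
      IsConj (N.complMeridian x₀)⁻¹ (N'.complMeridian x₀) := by
  obtain ⟨r, a, T, ha, hT, hTs⟩ := exists_isUnit_polar_lift N N'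
  obtain ⟨h, m, hh, hm, hm', hmc⟩ := N.exists_polar_transport x₀
  obtain ⟨h', m', hh', hn, -, hnc⟩ := N'.exists_polar_transport x₀
  let σ : Path (0 : ℝ × ℂ) (0 + meridianShift 1) := PathConnectedSpace.somePath _ _
  have h1 := hh (σ.map T.continuous)
  have h2 := hh' (σ.map (radialClamp r).continuous)
  rw [transport_congr x₀ (γ' := (σ.map (radialClamp r).continuous).map N'.polar.continuous)
    fun t => hT (σ t), h2, radialClamp_add_meridianShift, hn, hTs] at h1
  have hconj : IsConj (h (T 0 + meridianShift a) * (h (T 0))⁻¹) (N'.complMeridian x₀) := by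
    rw [← h1]
    exact IsConj.trans (isConj_iff.2 ⟨_, rfl⟩).symm hnc
  rcases ha with rfl | rfl
  · rw [hm] at hconj
    exact Or.inl (hmc.symm.trans ((isConj_iff.2 ⟨_, rfl⟩).trans hconj))
  · rw [hm'] at hconj
    obtain ⟨c, hc⟩ := isConj_iff.1 hmc
    have hinv : IsConj m⁻¹ (N.complMeridian x₀)⁻¹ := isConj_iff.2 ⟨c, by rw [← hc]; group⟩
    exact Or.inr (hinv.symm.trans ((isConj_iff.2 ⟨_, rfl⟩).trans hconj))

end TubularNeighbourhood

end MeridianComparison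

/-! ### The exterior as a retract of the complement -/

section Retraction

/-- A continuous map induces a homomorphism of fundamental groups also when the basepoints are not
related, by means of the transport. -/
theorem exists_monoidHom_transport {X Y : Type*} [TopologicalSpace X] [TopologicalSpace Y]
    [PathConnectedSpace X] (x₀ : X) (e : C(X, Y)) {x₁ : X} {y₁ : Y} (h : e x₁ = y₁) :
    ∃ ψ : FundamentalGroup X x₀ →* FundamentalGroup Y y₁, ∀ γ : Path x₁ x₁,
      ψ (transport x₀ γ) =
        FundamentalGroup.fromPath (.mk ((γ.map e.continuous).cast h.symm h.symm)) := by
  subst h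
  refine ⟨(FundamentalGroup.map e x₁).comp (FundamentalGroup.fundamentalGroupMulEquivOfPath
    (PathConnectedSpace.somePath x₀ x₁)).toMonoidHom, fun γ => ?_⟩
  have h1 : FundamentalGroup.fundamentalGroupMulEquivOfPath (PathConnectedSpace.somePath x₀ x₁)
      (transport x₀ γ) = FundamentalGroup.fromPath (.mk γ) := by
    change (Path.Homotopic.Quotient.mk (PathConnectedSpace.somePath x₀ x₁)).symm.trans
      ((((Path.Homotopic.Quotient.mk (PathConnectedSpace.somePath x₀ x₁)).trans (.mk γ)).trans
      (Path.Homotopic.Quotient.mk (PathConnectedSpace.somePath x₀ x₁)).symm).trans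
      (Path.Homotopic.Quotient.mk (PathConnectedSpace.somePath x₀ x₁))) = .mk γ
    simp only [Path.Homotopic.Quotient.trans_assoc, Path.Homotopic.Quotient.symm_trans,
      Path.Homotopic.Quotient.trans_refl]
    rw [← Path.Homotopic.Quotient.trans_assoc, Path.Homotopic.Quotient.symm_trans,
      Path.Homotopic.Quotient.refl_trans]
  change FundamentalGroup.map e x₁ (FundamentalGroup.fundamentalGroupMulEquivOfPath
    (PathConnectedSpace.somePath x₀ x₁) (transport x₀ γ)) = _
  rw [h1]
  rfl

namespace TubularNeighbourhood

variable {K : Set S3} (N : TubularNeighbourhood K)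

theorem exterior_subset_compl : N.exterior ⊆ Kᶜ := by
  intro x hx hxK
  rw [← N.range_core] at hxK
  obtain ⟨z, rfl⟩ := hxK
  exact hx ⟨(z, 0), by simp, rfl⟩

/-- The inclusion of the exterior in the complement of the knot. -/
def complInclusion : C(N.exterior, ↥Kᶜ) :=
  ⟨Set.inclusion N.exterior_subset_compl, continuous_inclusion _⟩

instance compactSpace_exterior : CompactSpace N.exterior :=
  isCompact_iff_compactSpace.1 (N.isOpenEmbedding.isOpenMap _
    (isOpen_lt (by fun_prop) continuous_const)).isClosed_compl.isCompact

/-- The factor by which the radial deformation of the complement of the knot to the exterior moves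
`w` away from `0`. -/
noncomputable def radialFactor (s : ℝ) (w : ℂ) : ℝ := 1 + s * (max 1 ‖w‖⁻¹ - 1)

theorem radialFactor_pos {s : ℝ} (hs : 0 ≤ s) (w : ℂ) : 0 < radialFactor s w := by
  have := mul_nonneg hs (sub_nonneg.2 (le_max_left 1 ‖w‖⁻¹))
  rw [radialFactor]
  linarith

theorem radialFactor_of_one_le (s : ℝ) {w : ℂ} (hw : 1 ≤ ‖w‖) : radialFactor s w = 1 := by
  rw [radialFactor, max_eq_left (inv_le_one_of_one_le₀ hw), sub_self, mul_zero, add_zero]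

open Classical in
/-- The radial deformation of the complement of the knot to the exterior, as a map of the sphere. -/
noncomputable def radialPush (s : ℝ) (y : S3) : S3 :=
  if y ∈ Set.range N.toFun then
    N.toFun ((N.coord y).1, (N.coord y).2 * (radialFactor s (N.coord y).2 : ℂ)) else y

theorem radialPush_toFun (s : ℝ) (z : Circle) (w : ℂ) :
    N.radialPush s (N.toFun (z, w)) = N.toFun (z, w * (radialFactor s w : ℂ)) := by
  rw [radialPush, if_pos ⟨_, rfl⟩, N.coord_toFun]

theorem radialPush_of_mem_exterior (s : ℝ) {y : S3} (hy : y ∈ N.exterior) :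
    N.radialPush s y = y := by
  by_cases h : y ∈ Set.range N.toFun
  · obtain ⟨⟨z, w⟩, rfl⟩ := h
    have hw : 1 ≤ ‖w‖ := not_lt.1 fun h => hy ⟨(z, w), h, rfl⟩
    rw [radialPush_toFun, radialFactor_of_one_le s hw, Complex.ofReal_one, mul_one]
  · exact if_neg h

theorem radialPush_mem_compl {s : ℝ} (hs : 0 ≤ s) {y : S3} (hy : y ∈ Kᶜ) :
    N.radialPush s y ∈ Kᶜ := by
  by_cases h : y ∈ Set.range N.toFun
  · obtain ⟨⟨z, w⟩, rfl⟩ := h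
    rw [radialPush_toFun, Set.mem_compl_iff, N.toFun_mem_iff, mul_eq_zero, not_or]
    exact ⟨fun h => hy ((N.toFun_mem_iff z w).2 h),
      Complex.ofReal_ne_zero.2 (radialFactor_pos hs w).ne'⟩
  · rwa [radialPush, if_neg h]

theorem radialPush_zero (y : S3) : N.radialPush 0 y = y := by
  by_cases h : y ∈ Set.range N.toFun
  · obtain ⟨⟨z, w⟩, rfl⟩ := h
    rw [radialPush_toFun, radialFactor, zero_mul, add_zero, Complex.ofReal_one, mul_one]
  · exact if_neg h

theorem radialPush_one_mem_exterior {y : S3} (hy : y ∈ Kᶜ) : N.radialPush 1 y ∈ N.exterior := by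
  by_cases h : y ∈ Set.range N.toFun
  · obtain ⟨⟨z, w⟩, rfl⟩ := h
    have hw : 0 < ‖w‖ := norm_pos_iff.2 fun h => hy ((N.toFun_mem_iff z w).2 h)
    rw [radialPush_toFun]
    rintro ⟨p, hp, hpz⟩
    obtain rfl := N.isOpenEmbedding.injective hpz
    have hp : ‖w * (radialFactor 1 w : ℂ)‖ < 1 := hp
    rw [norm_mul, Complex.norm_real, Real.norm_of_nonneg (radialFactor_pos zero_le_one w).le,
      radialFactor, one_mul, add_sub_cancel] at hp
    have h1 := mul_le_mul_of_nonneg_left (le_max_right 1 ‖w‖⁻¹) hw.le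
    rw [mul_inv_cancel₀ hw.ne'] at h1
    linarith
  · rw [radialPush, if_neg h]
    rintro ⟨p, -, hp⟩
    exact h ⟨p, hp⟩

theorem continuous_radialPush :
    Continuous fun q : ℝ × ↥Kᶜ => N.radialPush q.1 q.2 := by
  rw [continuous_iff_continuousAt]
  rintro ⟨s, y, hy⟩
  have hval : Continuous fun q : ℝ × ↥Kᶜ => (q.2 : S3) := by fun_prop
  by_cases h : y ∈ Set.range N.toFun
  · obtain ⟨⟨z, w⟩, rfl⟩ := h
    have hw : ‖w‖ ≠ 0 := norm_ne_zero_iff.2 fun h => hy ((N.toFun_mem_iff z w).2 h)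
    have hcoord : ContinuousAt (fun q : ℝ × ↥Kᶜ => N.coord q.2) (s, ⟨N.toFun (z, w), hy⟩) :=
      ContinuousAt.comp (g := N.coord) (f := fun q : ℝ × ↥Kᶜ => (q.2 : S3))
        (N.continuousAt_coord (z, w)) hval.continuousAt
    have hnorm : ‖(N.coord (N.toFun (z, w))).2‖ ≠ 0 := by rwa [N.coord_toFun]
    have hfac : ContinuousAt (fun q : ℝ × ↥Kᶜ => radialFactor q.1 (N.coord q.2).2)
        (s, ⟨N.toFun (z, w), hy⟩) := by
      unfold radialFactor
      exact continuousAt_const.add (continuousAt_fst.mul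
        ((continuousAt_const.max (hcoord.snd.norm.inv₀ hnorm)).sub continuousAt_const))
    have hc : ContinuousAt (fun q : ℝ × ↥Kᶜ => N.toFun ((N.coord q.2).1,
        (N.coord q.2).2 * (radialFactor q.1 (N.coord q.2).2 : ℂ)))
        (s, ⟨N.toFun (z, w), hy⟩) :=
      N.isOpenEmbedding.continuous.continuousAt.comp
        (hcoord.fst.prodMk (hcoord.snd.mul (Complex.continuous_ofReal.continuousAt.comp hfac)))
    refine hc.congr ?_
    filter_upwards [hval.continuousAt.preimage_mem_nhds
      (N.isOpenEmbedding.isOpen_range.mem_nhds ⟨(z, w), rfl⟩)] with q hq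
    exact (if_pos hq).symm
  · have hcomp : IsCompact {p : Circle × ℂ | ‖p.2‖ ≤ 1} := by
      have h1 := (isCompact_univ (X := Circle)).prod (isCompact_closedBall (0 : ℂ) 1)
      convert h1 using 1
      ext p
      simp
    have hclosed := (hcomp.image N.isOpenEmbedding.continuous).isClosed
    refine hval.continuousAt.congr ?_
    filter_upwards [hval.continuousAt.preimage_mem_nhds (hclosed.isOpen_compl.mem_nhds
      (show y ∈ _ from fun h' => h (Set.image_subset_range _ _ h')))] with q hq
    refine (N.radialPush_of_mem_exterior q.1 ?_).symm
    rintro ⟨p, hp, hpq⟩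
    have hp : ‖p.2‖ < 1 := hp
    exact hq ⟨p, hp.le, hpq⟩

/-- The retraction of the complement of the knot to the exterior. -/
noncomputable def retraction : C(↥Kᶜ, N.exterior) where
  toFun y := ⟨N.radialPush 1 y, N.radialPush_one_mem_exterior y.2⟩
  continuous_toFun := Continuous.subtype_mk
    (N.continuous_radialPush.comp (continuous_const.prodMk continuous_id)) _

theorem retraction_complInclusion (y : N.exterior) : N.retraction (N.complInclusion y) = y :=
  Subtype.ext (N.radialPush_of_mem_exterior 1 y.2)

/-- Every loop at a point of the exterior can be deformed into the exterior. -/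
theorem homotopic_map_retraction {y : N.exterior}
    (γ : Path (N.complInclusion y) (N.complInclusion y)) :
    ∃ γ' : Path y y, γ.Homotopic (γ'.map N.complInclusion.continuous) := by
  refine ⟨(γ.map N.retraction.continuous).cast (N.retraction_complInclusion y).symm
    (N.retraction_complInclusion y).symm, ⟨⟨⟨⟨fun p => ⟨N.radialPush p.1 (γ p.2),
      N.radialPush_mem_compl p.1.2.1 (γ p.2).2⟩, ?_⟩, ?_, ?_⟩, ?_⟩⟩⟩
  · exact Continuous.subtype_mk (N.continuous_radialPush.comp
      ((continuous_subtype_val.comp continuous_fst).prodMk (γ.continuous.comp continuous_snd))) _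
  · intro t
    exact Subtype.ext (N.radialPush_zero _)
  · intro t
    rfl
  · rintro t x (rfl | rfl)
    · refine Subtype.ext ?_
      change N.radialPush t (γ 0) = (γ 0 : S3)
      rw [γ.source]
      exact N.radialPush_of_mem_exterior t y.2
    · refine Subtype.ext ?_
      change N.radialPush t (γ 1) = (γ 1 : S3)
      rw [γ.target]
      exact N.radialPush_of_mem_exterior t y.2

variable [PathConnectedSpace ↥Kᶜ] (x₀ : ↥Kᶜ)

theorem exists_transport_complInclusion_eq (y : N.exterior) (g : FundamentalGroup ↥Kᶜ x₀) :
    ∃ γ : Path y y, transport x₀ (γ.map N.complInclusion.continuous) = g := by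
  obtain ⟨γ, rfl⟩ := exists_transport_eq x₀ (N.complInclusion y) g
  obtain ⟨γ', h⟩ := N.homotopic_map_retraction γ
  exact ⟨γ', (transport_homotopic x₀ h).symm⟩

include N in
theorem fg_fundamentalGroup_compl : Group.FG (FundamentalGroup ↥Kᶜ x₀) := by
  have : StronglyLocallyContractibleSpace ↥Kᶜ := N.isOpen_compl.stronglyLocallyContractibleSpace
  obtain ⟨H, hH, hγ⟩ := exists_fg_forall_transport_mem x₀
    (isCompact_range N.complInclusion.continuous) (N.complInclusion (N.inclusion N.basepoint))
  have htop : H = ⊤ := by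
    rw [eq_top_iff]
    intro g _
    obtain ⟨γ, rfl⟩ := N.exists_transport_complInclusion_eq x₀ (N.inclusion N.basepoint) g
    exact hγ _ fun t => ⟨γ t, rfl⟩
  exact ⟨htop ▸ hH⟩

theorem complMeridian_eq_transport : N.complMeridian x₀ =
    transport x₀ ((N.meridianLoop.map N.inclusion.continuous).map N.complInclusion.continuous) := by
  refine transport_congr x₀ fun t => Subtype.ext ?_
  change N.toFun (Circle.exp 0, Complex.exp ((t : ℝ) * (2 * Real.pi * Complex.I))) =
    N.toFun (1, (Circle.exp (2 * Real.pi * (t : ℝ)) : ℂ))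
  rw [Circle.exp_zero, Circle.coe_exp]
  congr 3
  push_cast
  ring

/-- The group of the complement of the knot maps onto the knot group, and the meridians correspond
to each other. -/
theorem exists_surjective_map_complMeridian :
    ∃ ψ : FundamentalGroup ↥Kᶜ x₀ →* N.knotGroup, Function.Surjective ψ ∧
      ψ (N.complMeridian x₀) = N.meridian := by
  obtain ⟨ψ, hψ⟩ := exists_monoidHom_transport x₀ N.retraction
    (N.retraction_complInclusion (N.inclusion N.basepoint))
  have hψ' : ∀ γ : Path (N.inclusion N.basepoint) (N.inclusion N.basepoint),
      ψ (transport x₀ (γ.map N.complInclusion.continuous)) =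
        FundamentalGroup.fromPath (.mk γ) := by
    intro γ
    rw [hψ]
    congr 2
    exact Path.ext (funext fun t => N.retraction_complInclusion (γ t))
  refine ⟨ψ, fun g => ?_, ?_⟩
  · obtain ⟨γ, hγ⟩ := Path.Homotopic.Quotient.mk_surjective g.toPath
    refine ⟨_, (hψ' γ).trans ?_⟩
    rw [hγ]
  · rw [complMeridian_eq_transport, hψ']
    rfl

end TubularNeighbourhood

end Retraction

/-! ### Representations with commutative image -/

section CommutativeImage

theorem mem_zpowers_of_commute {Γ G : Type*} [Group Γ] [Group G] (f : Γ →* G) {μ : Γ}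
    (hμ : Subgroup.normalClosure {μ} = ⊤) (hf : ∀ g h, Commute (f g) (f h)) (g : Γ) :
    f g ∈ Subgroup.zpowers (f μ) := by
  have hn : ((Subgroup.zpowers (f μ)).comap f).Normal := ⟨fun n hn g => by
    rw [Subgroup.mem_comap] at hn ⊢
    rwa [map_mul, map_mul, (hf g n).eq, map_inv, mul_inv_cancel_right]⟩
  have hle : Subgroup.normalClosure {μ} ≤ (Subgroup.zpowers (f μ)).comap f :=
    Subgroup.normalClosure_le_normal (by
      rw [Set.singleton_subset_iff]
      exact Subgroup.mem_zpowers (f μ))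
  exact hle (hμ ▸ Subgroup.mem_top g)

namespace TubularNeighbourhood

open TwistedCohomology

variable {K : Set S3}

/-- A class in the kernel of the restriction to the boundary torus is represented by a crossed
homomorphism that is principal on the meridian.  If all such crossed homomorphisms are principal,
then the kernel vanishes. -/
theorem restrictionKernel_eq_bot (N : TubularNeighbourhood K) (ρ : N.knotGroup →* SL(2, ℂ))
    (h : ∀ y : N.knotGroup → SL2LieAlgebra, IsCrossedHom (N.adRep ρ) y →
      (∃ v, y N.meridian = N.adRep ρ N.meridian v - v) →
      ∃ v, ∀ g, y g = N.adRep ρ g v - v) : N.restrictionKernel ρ = ⊥ := by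
  rw [eq_bot_iff]
  intro x hx
  obtain ⟨⟨c, hc⟩, rfl⟩ := Submodule.Quotient.mk_surjective _ x
  have hker : cochainMap N.inclusion N.basepoint (N.adRep ρ) 1 c ∈
      coboundaries (pullbackRep N.inclusion N.basepoint (N.adRep ρ)) 1 :=
    (Submodule.Quotient.mk_eq_zero
      ((coboundaries (pullbackRep N.inclusion N.basepoint (N.adRep ρ)) 1).submoduleOf
        (cocycles (pullbackRep N.inclusion N.basepoint (N.adRep ρ)) 1))).1 (LinearMap.mem_ker.1 hx)
  obtain ⟨y, hy, hyc, hcob⟩ := exists_crossedHom_of_cocycle hc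
  obtain ⟨v, hv⟩ := exists_liftedPath_map_eq_of_mem_ker N.inclusion N.basepoint hker N.meridianLoop
  have hm : ∃ v, y N.meridian⁻¹ = N.adRep ρ N.meridian⁻¹ v - v :=
    ⟨v, (hyc (N.meridianLoop.map N.inclusion.continuous)).trans hv⟩
  have hm' := hy.principal_inv hm
  rw [inv_inv] at hm'
  exact (Submodule.Quotient.mk_eq_zero _).2 (hcob (h y hy hm'))

theorem adjointRep_commute {Γ : Type*} [Group Γ] (f : Γ →* SL(2, ℂ))
    (hf : ∀ g h, Commute (f g) (f h)) (g h : Γ) :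
    Commute ((adjointRep.comp f : Representation ℂ Γ SL2LieAlgebra) g)
      ((adjointRep.comp f : Representation ℂ Γ SL2LieAlgebra) h) :=
  (hf g h).map adjointRep

end TubularNeighbourhood

end CommutativeImage

theorem mainTheorem3 (K : Set S3) (hK : IsKnot K) :
    ∃ U₁ U₂ : Set SL(2, ℂ),
      IsOpen U₁ ∧ (1 : SL(2, ℂ)) ∈ U₁ ∧ IsOpen U₂ ∧ (-1 : SL(2, ℂ)) ∈ U₂ ∧
      ∀ (N : TubularNeighbourhood K) (ρ : N.knotGroup →* SL(2, ℂ)),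
        (∀ g h : N.knotGroup, Commute (ρ g) (ρ h)) →
        ρ N.meridian ∈ U₁ ∪ U₂ → ρ N.meridian ≠ 1 → ρ N.meridian ≠ -1 →
          FiniteDimensional ℂ (TwistedCohomology.H (N.adRep ρ) 0) ∧
          FiniteDimensional ℂ (N.restrictionKernel ρ) ∧
          N.deltaRep ρ = 2 := by
  obtain ⟨N₀⟩ := hK
  have := N₀.pathConnectedSpace_compl
  obtain ⟨x₀⟩ : Nonempty ↥Kᶜ := inferInstance
  have := N₀.fg_fundamentalGroup_compl x₀
  obtain ⟨ε, hε, hprincipal⟩ := exists_pos_forall_crossedHom_principal (N₀.complMeridian x₀)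
    (N₀.normalClosure_complMeridian x₀)
  obtain ⟨U, hU, hU1, hUε⟩ := exists_isOpen_adjointRep_near_one hε
  have hneg : Continuous fun A : SL(2, ℂ) => -A :=
    continuous_induced_rng.2 (continuous_subtype_val (p := fun A => Matrix.det A = 1)).neg
  -- The adjoint representation does not distinguish `A` from `-A`.
  refine ⟨U, {A | -A ∈ U}, hU, hU1, hU.preimage hneg, by simpa using hU1,
    fun N ρ hρ hρU h1 h2 => ?_⟩
  have hnear : (∀ X, sl2Seminorm (adjointRep (ρ N.meridian) X - X) ≤ ε * sl2Seminorm X) ∧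
      ∀ X, sl2Seminorm (adjointRep (ρ N.meridian)⁻¹ X - X) ≤ ε * sl2Seminorm X := by
    rcases hρU with h | h
    · exact hUε _ h
    · have h3 := hUε _ h
      have h4 : (-ρ N.meridian)⁻¹ = -(ρ N.meridian)⁻¹ := by
        rw [inv_eq_iff_mul_eq_one, neg_mul_neg, mul_inv_cancel]
      rwa [h4, adjointRep_neg, adjointRep_neg] at h3
  obtain ⟨ψ, hψ, hψμ⟩ := N.exists_surjective_map_complMeridian x₀
  have hcomm : ∀ g h, Commute ((ρ.comp ψ) g) ((ρ.comp ψ) h) := fun g h => hρ (ψ g) (ψ h)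
  -- The image is commutative, so that the meridians of `N₀` and `N` have the same image up to
  -- inversion.
  have hμ : ∀ μ, IsConj μ (N.complMeridian x₀) → ρ (ψ μ) = ρ N.meridian := by
    intro μ hμ
    obtain ⟨c, hc⟩ := isConj_iff.1 hμ
    rw [← hψμ, ← hc, map_mul, map_mul, map_mul, map_mul, (hρ (ψ c) (ψ μ)).eq, map_inv, map_inv,
      mul_inv_cancel_right]
  have hnear₀ : (∀ X, sl2Seminorm (adjointRep (ρ (ψ (N₀.complMeridian x₀))) X - X) ≤
        ε * sl2Seminorm X) ∧
      ∀ X, sl2Seminorm (adjointRep (ρ (ψ (N₀.complMeridian x₀)⁻¹)) X - X) ≤ ε * sl2Seminorm X := by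
    rcases N₀.isConj_complMeridian N x₀ with h | h
    · rw [map_inv, map_inv, hμ _ h]
      exact hnear
    · have h3 := hμ _ h
      rw [h3]
      rw [map_inv, map_inv, inv_eq_iff_eq_inv] at h3
      rw [h3]
      exact hnear.symm
  have hker : N.restrictionKernel ρ = ⊥ := by
    refine N.restrictionKernel_eq_bot ρ fun y hy hyμ => ?_
    have hz := hy.comp ψ
    have hz₀ : ∃ v, y (ψ (N₀.complMeridian x₀)) =
        (N.adRep ρ).comp ψ (N₀.complMeridian x₀) v - v := by
      rw [← hψμ] at hyμ
      rcases (N₀.isConj_complMeridian N x₀).imp IsConj.symm IsConj.symm with h | h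
      · obtain ⟨c, hc⟩ := isConj_iff.1 h
        rw [← hc]
        exact hz.principal_conj hyμ c
      · obtain ⟨c, hc⟩ := isConj_iff.1 h
        have h3 := hz.principal_inv (hz.principal_conj hyμ c)
        rw [hc, inv_inv] at h3
        exact h3
    obtain ⟨v, hv⟩ := hprincipal SL2LieAlgebra ((N.adRep ρ).comp ψ) sl2Seminorm (fun g => y (ψ g))
      eq_zero_of_sl2Seminorm_eq_zero
      (fun g h => TubularNeighbourhood.adjointRep_commute ρ hρ (ψ g) (ψ h))
      hnear₀.1 hnear₀.2 hz hz₀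
    refine ⟨v, fun g => ?_⟩
    obtain ⟨g, rfl⟩ := hψ g
    exact hv g
  have hpow : ∀ g, ρ g ∈ Subgroup.zpowers (ρ N.meridian) := by
    intro g
    obtain ⟨g, rfl⟩ := hψ g
    rw [← hψμ]
    exact mem_zpowers_of_commute (ρ.comp ψ) (N.normalClosure_complMeridian x₀) hcomm g
  obtain ⟨e⟩ := TwistedCohomology.nonempty_H_zero_equiv_invariants (N.adRep ρ)
  have h0 : N.h0 ρ = 1 :=
    e.finrank_eq.trans (finrank_invariants_eq_one ρ N.meridian hpow h1 h2)
  have hk : N.h1 ρ = 0 := by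
    rw [TubularNeighbourhood.h1, hker, finrank_bot]
  refine ⟨FiniteDimensional.of_finrank_pos ?_, ?_, ?_⟩
  · change 0 < N.h0 ρ
    rw [h0]
    exact one_pos
  · exact Module.Finite.iff_fg.2 (hker ▸ Submodule.fg_bot)
  · rw [TubularNeighbourhood.deltaRep, h0, hk]
    norm_num
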